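/- Theorem 3 (most-reliable-path improvement can be solved in polynomial time). An uncertain graph $\mathcal G=(V,E,p)$ consists of a finite set $V$ of $n$ nodes, a set $E\subseteq V\times V$ of directed edges, and probabilities $p(e)\in[0,1]$, $e\in E$. The probability of a (simple, directed) path is the product of the probabilities of its edges, and a most reliable path from $s$ to $t$ is a path from $s$ to $t$ of maximum probability. Consider the following problem: given $\mathcal G$, nodes $s,t\in V$, a number $\zeta\in(0,1]$ and a positive integer $k\le |(V\times V)\setminus E|$, find a set $E_1\subseteq (V\times V)\setminus E$ with $|E_1|=k$ that maximizes the probability of the most reliable path from $s$ to $t$ in the updated graph $(V,E\cup E_1,p)$, where $p(e)=\zeta$ for all $e\in E_1$. This problem can be solved exactly in polynomial time. More precisely, there is a single random access machine program, working with machine words of $O(\log n)$ bits and with number registers and a number memory on which it only uses the constants $0$ and $1$, copying, multiplication and comparison, which on every instance (given by $n,k,s,t,\zeta$, the adjacency matrix and the matrix of edge probabilities) halts and outputs the adjacency matrix of an optimal set $E_1$, such that (i) for arbitrary real probabilities, with unit cost per operation, its running time is $O\bigl(k^2n^2+k^2n\log(kn)\bigr)$, with an absolute constant; (ii) for rational $\zeta$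 and rational edge probabilities (fractions with binary numerator and denominator), its running time, with every operation on numbers charged in addition the binary length of its operands, is bounded by a polynomial in the number of bits of the input. -/

import Mathlib

/-! ### Uncertain graphs and most reliable paths -/

/-- An uncertain directed graph on the node set `V`: a set of directed edges, each edge `e` being
present with probability `p e ∈ [0,1]`.  Values of `p` off the edge set are meaningless.
`K` is the ordered field the probabilities live in (`ℝ` or `ℚ`). -/
structure UncertainGraph (K V : Type) [Field K] [LinearOrder K] where
  edges : Finset (V × V)
  p : V × V → K
  p_mem : ∀ e ∈ edges, 0 ≤ p e ∧ p e ≤ 1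

namespace UncertainGraph

variable {K V : Type} [Field K] [LinearOrder K]

/-- `l` is the list of nodes of a (simple, directed) path from `s` to `t` in `G`.
For `s = t` the path `[s]` without edges is included. -/
def IsPath (G : UncertainGraph K V) (s t : V) (l : List V) : Prop :=
  l.head? = some s ∧ l.getLast? = some t ∧ l.Nodup ∧
    l.IsChain (fun u v => (u, v) ∈ G.edges)

/-- The probability of a path: the product of the probabilities of its edges, which are the
pairs of consecutive nodes. -/
def pathProb (G : UncertainGraph K V) (l : List V) : K :=
  ((l.zip l.tail).map G.p).prod

/-- `l` is a most reliable path from `s` to `t` in `G`. -/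
def IsMostReliablePath (G : UncertainGraph K V) (s t : V) (l : List V) : Prop :=
  G.IsPath s t l ∧ ∀ l', G.IsPath s t l' → G.pathProb l' ≤ G.pathProb l

/-- The updated graph `(V, E ∪ E₁, p)` with `p e = ζ` for the new edges `e ∈ E₁`. -/
def addEdges [DecidableEq V] (G : UncertainGraph K V) (E₁ : Finset (V × V)) (ζ : K)
    (hζ : 0 < ζ ∧ ζ ≤ 1) : UncertainGraph K V where
  edges := G.edges ∪ E₁
  p := fun e => if e ∈ E₁ then ζ else G.p e
  p_mem := by
    intro e he
    by_cases h : e ∈ E₁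
    · simp only [h, if_true]
      exact ⟨hζ.1.le, hζ.2⟩
    · simp only [h, if_false]
      rcases Finset.mem_union.1 he with h' | h'
      · exact G.p_mem e h'
      · exact absurd h' h

end UncertainGraph

/-- An instance of the most-reliable-path improvement problem with `n` nodes: an uncertain graph,
a source, a target, a probability `ζ ∈ (0,1]`, and a budget `k ≥ 1` of new edges for which
`k` missing edges exist (otherwise there is no feasible choice). -/
structure MRPInstance (K : Type) [Field K] [LinearOrder K] (n : ℕ) where
  G : UncertainGraph K (Fin n)
  s : Fin n
  t : Fin n
  ζ : K
  hζ : 0 < ζ ∧ ζ ≤ 1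
  k : ℕ
  k_pos : 1 ≤ k
  k_le : k ≤ (G.edgesᶜ).card

namespace MRPInstance

variable {K : Type} [Field K] [LinearOrder K] {n : ℕ}

/-- The updated graph. -/
def updated (I : MRPInstance K n) (E₁ : Finset (Fin n × Fin n)) : UncertainGraph K (Fin n) :=
  I.G.addEdges E₁ I.ζ I.hζ

/-- `E₁ ⊆ V × V \ E` and `|E₁| = k`. -/
def IsFeasible (I : MRPInstance K n) (E₁ : Finset (Fin n × Fin n)) : Prop :=
  E₁ ⊆ I.G.edgesᶜ ∧ E₁.card = I.k

/-- `E₁` maximizes, over all feasible edge sets, the probability of the most reliable path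
from `s` to `t` in the updated graph. -/
def IsSolution (I : MRPInstance K n) (E₁ : Finset (Fin n × Fin n)) : Prop :=
  I.IsFeasible E₁ ∧
    ∃ P, (I.updated E₁).IsMostReliablePath I.s I.t P ∧
      ∀ E₂, I.IsFeasible E₂ → ∀ Q, (I.updated E₂).IsMostReliablePath I.s I.t Q →
        (I.updated E₂).pathProb Q ≤ (I.updated E₁).pathProb P

end MRPInstance

/-! ### The machine model

A random access machine with
* word registers and an indirectly addressed word memory, whose contents are natural numbers that
  may never exceed a bound `W` (machine words);
* number registers and an indirectly addressed number memory, whose contents are elements of an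
  ordered field `K`; numbers can only be copied, multiplied and compared, and the only constants
  are `0` and `1`.

Programs are finite and structured, and do not depend on `K`, on `W` or on the input. -/

namespace RAM

/-- Memory configuration of the machine. -/
structure State (K : Type) where
  reg : ℕ → ℕ
  mem : ℕ → ℕ
  num : ℕ → K
  numMem : ℕ → K

/-- Basic instructions; the arguments are register names. -/
inductive Op where
  /-- `reg d := c` -/
  | const (d c : ℕ)
  /-- `reg d := reg a` -/
  | move (d a : ℕ)
  /-- `reg d := reg a + reg b` -/
  | add (d a b : ℕ)
  /-- `reg d := reg a - reg b`, truncated at `0` -/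
  | sub (d a b : ℕ)
  /-- `reg d := reg a * reg b` -/
  | mul (d a b : ℕ)
  /-- `reg d := mem[reg a]` -/
  | load (d a : ℕ)
  /-- `mem[reg a] := reg b` -/
  | store (a b : ℕ)
  /-- `num d := 0` -/
  | numZero (d : ℕ)
  /-- `num d := 1` -/
  | numOne (d : ℕ)
  /-- `num d := num a` -/
  | numMove (d a : ℕ)
  /-- `num d := num a * num b` -/
  | numMul (d a b : ℕ)
  /-- `num d := numMem[reg a]` -/
  | numLoad (d a : ℕ)
  /-- `numMem[reg a] := num b` -/
  | numStore (a b : ℕ)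

/-- Tests for branching and loops. -/
inductive Test where
  /-- `reg a ≤ reg b` -/
  | le (a b : ℕ)
  /-- `num a ≤ num b` -/
  | numLe (a b : ℕ)

/-- Programs. -/
inductive Cmd where
  | skip
  | op (o : Op)
  | seq (P Q : Cmd)
  | ite (b : Test) (P Q : Cmd)
  | loop (b : Test) (P : Cmd)

variable {K : Type} [Field K] [LinearOrder K]

/-- The effect of a basic instruction. -/
def Op.run (σ : State K) : Op → State K
  | .const d c => { σ with reg := Function.update σ.reg d c }
  | .move d a => { σ with reg := Function.update σ.reg d (σ.reg a) }
  | .add d a b => { σ with reg := Function.update σ.reg d (σ.reg a + σ.reg b) }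
  | .sub d a b => { σ with reg := Function.update σ.reg d (σ.reg a - σ.reg b) }
  | .mul d a b => { σ with reg := Function.update σ.reg d (σ.reg a * σ.reg b) }
  | .load d a => { σ with reg := Function.update σ.reg d (σ.mem (σ.reg a)) }
  | .store a b => { σ with mem := Function.update σ.mem (σ.reg a) (σ.reg b) }
  | .numZero d => { σ with num := Function.update σ.num d 0 }
  | .numOne d => { σ with num := Function.update σ.num d 1 }
  | .numMove d a => { σ with num := Function.update σ.num d (σ.num a) }
  | .numMul d a b => { σ with num := Function.update σ.num d (σ.num a * σ.num b) }
  | .numLoad d a => { σ with num := Function.update σ.num d (σ.numMem (σ.reg a)) }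
  | .numStore a b => { σ with numMem := Function.update σ.numMem (σ.reg a) (σ.num b) }

/-- The word computed by the instruction does not exceed the word bound `W`.  (Instructions that
only copy words, or subtract, cannot overflow.) -/
def Op.Fits (W : ℕ) (σ : State K) : Op → Prop
  | .const _ c => c ≤ W
  | .add _ a b => σ.reg a + σ.reg b ≤ W
  | .mul _ a b => σ.reg a * σ.reg b ≤ W
  | _ => True

/-- The cost of an instruction: one unit, plus the sizes `sz` of the numbers that are handled. -/
def Op.cost (sz : K → ℕ) (σ : State K) : Op → ℕ
  | .numMove _ a => 1 + sz (σ.num a)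
  | .numMul _ a b => 1 + (sz (σ.num a) + sz (σ.num b))
  | .numLoad _ a => 1 + sz (σ.numMem (σ.reg a))
  | .numStore _ b => 1 + sz (σ.num b)
  | _ => 1

/-- The outcome of a test. -/
def Test.Holds (σ : State K) : Test → Prop
  | .le a b => σ.reg a ≤ σ.reg b
  | .numLe a b => σ.num a ≤ σ.num b

/-- The cost of a test. -/
def Test.cost (sz : K → ℕ) (σ : State K) : Test → ℕ
  | .le _ _ => 1
  | .numLe a b => 1 + (sz (σ.num a) + sz (σ.num b))

/-- `Exec sz W P σ T τ`: with word bound `W`, the program `P` started in `σ` halts in `τ` without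
overflow, at total cost `T`.  This is deterministic: at most one rule applies at each point. -/
inductive Exec (sz : K → ℕ) (W : ℕ) : Cmd → State K → ℕ → State K → Prop where
  | skip (σ : State K) : Exec sz W .skip σ 1 σ
  | op (o : Op) (σ : State K) (h : o.Fits W σ) : Exec sz W (.op o) σ (o.cost sz σ) (o.run σ)
  | seq {P Q : Cmd} {σ σ' σ'' : State K} {T T' : ℕ}
      (hP : Exec sz W P σ T σ') (hQ : Exec sz W Q σ' T' σ'') :
      Exec sz W (.seq P Q) σ (T + T') σ''
  | iteTrue {b : Test} {P Q : Cmd} {σ σ' : State K} {T : ℕ} (hb : b.Holds σ)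
      (hP : Exec sz W P σ T σ') : Exec sz W (.ite b P Q) σ (b.cost sz σ + T) σ'
  | iteFalse {b : Test} {P Q : Cmd} {σ σ' : State K} {T : ℕ} (hb : ¬ b.Holds σ)
      (hQ : Exec sz W Q σ T σ') : Exec sz W (.ite b P Q) σ (b.cost sz σ + T) σ'
  | loopTrue {b : Test} {P : Cmd} {σ σ' σ'' : State K} {T T' : ℕ} (hb : b.Holds σ)
      (hP : Exec sz W P σ T σ') (hL : Exec sz W (.loop b P) σ' T' σ'') :
      Exec sz W (.loop b P) σ (b.cost sz σ + T + T') σ''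
  | loopFalse {b : Test} {P : Cmd} {σ : State K} (hb : ¬ b.Holds σ) :
      Exec sz W (.loop b P) σ (b.cost sz σ) σ

/-- Unit-cost criterion: every instruction and every test costs one unit. -/
def unitCost : ℝ → ℕ := fun _ => 0

/-- Binary length of a rational number; charging it to every operation on numbers gives the
bit-cost criterion. -/
def bitLength (q : ℚ) : ℕ := q.num.natAbs.size + q.den.size

end RAM

namespace MRPInstance

variable {K : Type} [Field K] [LinearOrder K] {n : ℕ}

/-- The entry of the probability matrix: `p (i, j)` for an edge, `0` for a missing edge. -/
def entry (I : MRPInstance K n) (e : Fin n × Fin n) : K :=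
  if e ∈ I.G.edges then I.G.p e else 0

/-- The initial memory configuration: `n`, `k`, `s`, `t` in word registers `0`, `1`, `2`, `3`, the
adjacency matrix row by row in the word memory (`finProdFinEquiv` sends `(i, j)` to `j + n * i`),
`ζ` in number register `0`, the probability matrix row by row in the number memory, and `0`
everywhere else. -/
def start (I : MRPInstance K n) : RAM.State K where
  reg := fun r => if r = 0 then n else if r = 1 then I.k else if r = 2 then I.s
    else if r = 3 then I.t else 0
  mem := fun a =>
    if h : a < n * n then (if finProdFinEquiv.symm ⟨a, h⟩ ∈ I.G.edges then 1 else 0) else 0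
  num := fun r => if r = 0 then I.ζ else 0
  numMem := fun a => if h : a < n * n then I.entry (finProdFinEquiv.symm ⟨a, h⟩) else 0

/-- The word memory of `σ` starts with the adjacency matrix of the edge set `E₁`. -/
def Outputs (σ : RAM.State K) (E₁ : Finset (Fin n × Fin n)) : Prop :=
  ∀ i j : Fin n, σ.mem (i * n + j) = if (i, j) ∈ E₁ then 1 else 0

/-- The program `P`, run on the input `I` with word bound `W`, halts without overflow at cost `T`
and outputs a solution of the instance `I`. -/
def SolvedBy (I : MRPInstance K n) (sz : K → ℕ) (W : ℕ) (P : RAM.Cmd) (T : ℕ) : Prop :=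
  ∃ (τ : RAM.State K) (E₁ : Finset (Fin n × Fin n)),
    RAM.Exec sz W P I.start T τ ∧ Outputs τ E₁ ∧ I.IsSolution E₁

/-- The number of bits of a rational instance: adjacency matrix, probability matrix, `ζ`, and the
words `n`, `k`, `s`, `t`. -/
def inputBits (I : MRPInstance ℚ n) : ℕ :=
  n * n + ∑ e, RAM.bitLength (I.entry e) + RAM.bitLength I.ζ +
    (n.size + I.k.size + (I.s : ℕ).size + (I.t : ℕ).size)

end MRPInstance

/-! Stack `k + 1` copies of the node set. An edge of the graph stays in its layer with its own
probability, a missing edge leads to the next layer with weight `ζ`, and one may also move up to the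
next copy of the same node with weight `1`. The optimum is the largest product of weights along a
walk from the copy of `s` in layer `0` to the copy of `t` in layer `k`.

A simple path in an updated graph uses each new edge at most once, hence at most `k` new edges. It
lifts to a walk that can be prolonged to layer `k` at no loss (`mul_pathProb_le`, `layer_mono`).
Conversely, a walk up to layer `k` uses at most `k` missing edges. Add these, and further missing
edges until there are `k`. The projection of the walk may repeat nodes, but cutting out cycles loses
nothing because all probabilities are at most `1` (`IsPath.extend`, `exists_path_of_link`).

Weights at most `1` never increase a product, so Dijkstra's algorithm works with products in place
of sums, using only multiplication and comparison (`DijkstraInv.step`). Optimality needs only what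
it leaves behind: the inequalities `D x * w x y ≤ D y`, and a predecessor attaining equality at each
node of positive value other than the source. If the target has value `0`, every feasible set is
optimal (`exists_path_of_le_zero`).

With plain arrays, `N = (k + 1) * n` rounds of `O(N)` steps cost `O(k²n²)`; the logarithmic term is
not needed. Each round lengthens a value by at most one factor, so numbers have size at most `(N +
1) * B`. One proof with an abstract subadditive size `sz` covers both cost models: `sz = 0` for unit
cost and `bitLength` for bit cost. -/

set_option linter.unusedSectionVars false

/-! ### A calculus for correctness, step counts and sizes of numbers -/

namespace RAM

variable {K : Type} [Field K] [LinearOrder K] {sz : K → ℕ} {W S : ℕ}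

/-- All numbers in the memory have size at most `S`. -/
def State.Small (sz : K → ℕ) (S : ℕ) (σ : State K) : Prop :=
  (∀ r, sz (σ.num r) ≤ S) ∧ ∀ a, sz (σ.numMem a) ≤ S

/-- The number created by the instruction has size at most `S`. -/
def Op.Small (sz : K → ℕ) (S : ℕ) (σ : State K) : Op → Prop
  | .numZero _ => sz 0 ≤ S
  | .numOne _ => sz 1 ≤ S
  | .numMul _ a b => sz (σ.num a * σ.num b) ≤ S
  | _ => True

theorem State.Small.run {σ : State K} (h : σ.Small sz S) {o : Op} (ho : o.Small sz S σ) :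
    (o.run σ).Small sz S := by
  obtain ⟨h₁, h₂⟩ := h
  cases o <;> refine ⟨fun r => ?_, fun a => ?_⟩ <;>
    simp only [Op.run, Function.update_apply, Op.Small] at ho ⊢ <;> (try split_ifs) <;>
    first | exact ho | apply h₁ | apply h₂

theorem Op.cost_le {σ : State K} (h : σ.Small sz S) (o : Op) : o.cost sz σ ≤ 1 + 2 * S := by
  obtain ⟨h₁, h₂⟩ := h
  cases o with
  | numMove d a => have := h₁ a; simp only [Op.cost]; omega
  | numMul d a b => have := h₁ a; have := h₁ b; simp only [Op.cost]; omega
  | numLoad d a => have := h₂ (σ.reg a); simp only [Op.cost]; omega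
  | numStore a b => have := h₁ b; simp only [Op.cost]; omega
  | _ => simp only [Op.cost]; omega

theorem Test.cost_le {σ : State K} (h : σ.Small sz S) (b : Test) : b.cost sz σ ≤ 1 + 2 * S := by
  cases b with
  | le a b => simp only [Test.cost]; omega
  | numLe a b => have := h.1 a; have := h.1 b; simp only [Test.cost]; omega

/-- Started in a state with numbers of size at most `S`, the program `P` halts without overflow
after at most `c` steps in a state satisfying `Q`, and all numbers stay of size at most `S`. -/
def Runs (sz : K → ℕ) (W S : ℕ) (P : Cmd) (σ : State K) (c : ℕ) (Q : State K → Prop) : Prop :=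
  σ.Small sz S → ∃ T τ, Exec sz W P σ T τ ∧ T ≤ c * (1 + 2 * S) ∧ τ.Small sz S ∧ Q τ

theorem Runs.mono {P : Cmd} {σ : State K} {c c' : ℕ} {Q Q' : State K → Prop}
    (h : Runs sz W S P σ c Q) (hc : c ≤ c') (hQ : ∀ τ, Q τ → Q' τ) : Runs sz W S P σ c' Q' := by
  intro hσ
  obtain ⟨T, τ, h₁, h₂, h₃, h₄⟩ := h hσ
  exact ⟨T, τ, h₁, h₂.trans (Nat.mul_le_mul_right _ hc), h₃, hQ _ h₄⟩

theorem Runs.seq {P P' : Cmd} {σ : State K} {c c' : ℕ} {Q Q' : State K → Prop}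
    (h : Runs sz W S P σ c Q) (h' : ∀ τ, Q τ → Runs sz W S P' τ c' Q') :
    Runs sz W S (.seq P P') σ (c + c') Q' := by
  intro hσ
  obtain ⟨T, τ, h₁, h₂, h₃, h₄⟩ := h hσ
  obtain ⟨T', τ', h₁', h₂', h₃', h₄'⟩ := h' τ h₄ h₃
  exact ⟨T + T', τ', .seq h₁ h₁', by rw [Nat.add_mul]; omega, h₃', h₄'⟩

/-- The weakest precondition of a loop-free program. -/
def Cmd.wp (sz : K → ℕ) (W S : ℕ) : Cmd → (State K → Prop) → State K → Prop
  | .skip, Q, σ => Q σ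
  | .op o, Q, σ => o.Fits W σ ∧ o.Small sz S σ ∧ Q (o.run σ)
  | .seq P P', Q, σ => P.wp sz W S (P'.wp sz W S Q) σ
  | .ite b P P', Q, σ => (b.Holds σ → P.wp sz W S Q σ) ∧ (¬ b.Holds σ → P'.wp sz W S Q σ)
  | .loop _ _, _, _ => False

/-- A bound for the number of steps of a loop-free program. -/
def Cmd.steps : Cmd → ℕ
  | .skip => 1
  | .op _ => 1
  | .seq P P' => P.steps + P'.steps
  | .ite _ P P' => 1 + (P.steps + P'.steps)
  | .loop _ _ => 0

/-- An instruction or test handles at most two numbers of size at most `S`, so it costs at most `1 +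
2 * S`. This reduces cost to counting steps, and correctness of straight-line code to
simplification. Both branches of a conditional are counted, which only overestimates. -/
theorem Runs.of_wp {P : Cmd} {σ : State K} {Q : State K → Prop} (h : P.wp sz W S Q σ) :
    Runs sz W S P σ P.steps Q := by
  induction P generalizing σ Q with
  | skip => exact fun hσ => ⟨1, σ, .skip σ, by simp only [Cmd.steps]; omega, hσ, h⟩
  | op o =>
    exact fun hσ => ⟨_, _, .op o σ h.1, by simpa [Cmd.steps] using o.cost_le hσ, hσ.run h.2.1, h.2.2⟩
  | seq P P' ih ih' => exact (ih h).seq fun τ hτ => ih' hτ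
  | ite b P P' ih ih' =>
    intro hσ
    have hb := b.cost_le hσ
    by_cases hc : b.Holds σ
    · obtain ⟨T, τ, h₁, h₂, h₃⟩ := ih (h.1 hc) hσ
      exact ⟨_, τ, .iteTrue hc h₁, by simp only [Cmd.steps, Nat.add_mul]; omega, h₃⟩
    · obtain ⟨T, τ, h₁, h₂, h₃⟩ := ih' (h.2 hc) hσ
      exact ⟨_, τ, .iteFalse hc h₁, by simp only [Cmd.steps, Nat.add_mul]; omega, h₃⟩
  | loop b P ih => exact h.elim

/-- Sequential composition of a list of programs. -/
def Cmd.block : List Cmd → Cmd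
  | [] => .skip
  | P :: L => .seq P (Cmd.block L)

/-- Repeat `P` with register `r` counting down to `0`; register `4` has to contain `1`. -/
def Cmd.down (r : ℕ) (P : Cmd) : Cmd :=
  .loop (.le 4 r) (.seq (.op (.sub r r 4)) P)

/-- The invariant is indexed by the counter. A round consists of the test, the decrement and the
body, hence `c + 2`; the final `1` is the failing test. -/
theorem Runs.down {r : ℕ} {P : Cmd} {c : ℕ} {Inv : ℕ → State K → Prop}
    (hreg : ∀ i σ, Inv i σ → σ.reg 4 = 1 ∧ σ.reg r = i)
    (hstep : ∀ i σ, Inv (i + 1) σ →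
      Runs sz W S P { σ with reg := Function.update σ.reg r i } c (Inv i)) :
    ∀ i σ, Inv i σ → Runs sz W S (.down r P) σ (i * (c + 2) + 1) (Inv 0) := by
  intro i
  induction i with
  | zero =>
    intro σ h hσ
    obtain ⟨h4, hr⟩ := hreg _ _ h
    exact ⟨_, σ, .loopFalse (by simp [Test.Holds, h4, hr]),
      by simpa using Test.cost_le hσ (.le 4 r), hσ, h⟩
  | succ i ih =>
    intro σ h hσ
    obtain ⟨h4, hr⟩ := hreg _ _ h
    have hrun : (Op.sub r r 4).run σ = { σ with reg := Function.update σ.reg r i } := by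
      simp [Op.run, h4, hr]
    obtain ⟨T, τ, h₁, h₂, h₃, h₄⟩ := hstep i σ h ⟨hσ.1, hσ.2⟩
    obtain ⟨T', τ', h₁', h₂', h₃', h₄'⟩ := ih τ h₄ h₃
    have hop : Exec sz W (.op (.sub r r 4)) σ ((Op.sub r r 4).cost sz σ) ((Op.sub r r 4).run σ) :=
      .op _ σ trivial
    rw [hrun] at hop
    refine ⟨_, τ', .loopTrue (by simp [Test.Holds, h4, hr]) (.seq hop h₁) h₁', ?_, h₃', h₄'⟩
    have e : ((i + 1) * (c + 2) + 1) * (1 + 2 * S) =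
        (i * (c + 2) + 1) * (1 + 2 * S) + c * (1 + 2 * S) + 2 * (1 + 2 * S) := by ring
    rw [e]
    simp only [Test.cost, Op.cost]
    omega

end RAM

/-! ### Dijkstra's algorithm for maximum products -/

section Dijkstra

variable {K : Type} [Field K] [LinearOrder K]

/-- The state of Dijkstra's algorithm on the nodes `0, …, N - 1` with `r` iterations to go: `D` are
the tentative values, `rank y` is `0` for open nodes and one more than the number of iterations
left after that node was closed otherwise, `par` are the predecessors.  The sizes of the values
grow by at most `B` per iteration. -/
structure DijkstraInv (sz : K → ℕ) (B N src : ℕ) (w : ℕ → ℕ → K) (r : ℕ)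
    (D : ℕ → K) (rank par : ℕ → ℕ) : Prop where
  nonneg : ∀ y < N, 0 ≤ D y
  le_one : ∀ y < N, D y ≤ 1
  src_eq : D src = 1
  par_src : par src = src
  card : ((Finset.range N).filter fun y => rank y ≠ 0).card + r = N
  rank_le : ∀ y < N, rank y ≤ N
  lt_rank : ∀ y < N, rank y ≠ 0 → r < rank y
  open_le : ∀ x < N, ∀ y < N, rank x ≠ 0 → rank y = 0 → D y ≤ D x
  relaxed : ∀ x < N, ∀ y < N, rank x ≠ 0 → D x * w x y ≤ D y
  -- Nodes of value `0` may never have received a predecessor. The rank increases strictly towards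
  -- the source, so following predecessors terminates.
  parent : ∀ y < N, y ≠ src → 0 < D y →
    par y < N ∧ rank y < rank (par y) ∧ D y = D (par y) * w (par y) y
  size_le : ∀ y < N, sz (D y) + r * B ≤ (N + 1) * B

variable {sz : K → ℕ} {B N src : ℕ} {w : ℕ → ℕ → K} {r : ℕ} {D : ℕ → K} {rank par : ℕ → ℕ}

/-- With `r + 1` rounds to go, only `N - (r + 1)` nodes are closed. -/
theorem DijkstraInv.exists_open (h : DijkstraInv sz B N src w (r + 1) D rank par) :
    ∃ x < N, rank x = 0 := by
  by_contra! hc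
  have := h.card
  rw [Finset.filter_true_of_mem (fun y hy => hc y (Finset.mem_range.1 hy)),
    Finset.card_range] at this
  omega

theorem DijkstraInv.rank_ne_zero (h : DijkstraInv sz B N src w 0 D rank par) {x : ℕ}
    (hx : x < N) : rank x ≠ 0 := by
  have h1 : ((Finset.range N).filter fun y => rank y ≠ 0) = Finset.range N := by
    apply Finset.eq_of_subset_of_card_le (Finset.filter_subset _ _)
    have := h.card
    simp only [Finset.card_range]
    omega
  have h2 : x ∈ (Finset.range N).filter fun y => rank y ≠ 0 := by
    rw [h1]; exact Finset.mem_range.2 hx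
  exact (Finset.mem_filter.1 h2).2

variable [IsStrictOrderedRing K]

theorem DijkstraInv.init (hsrc : src < N) (h0 : sz 0 ≤ B) (h1 : sz 1 ≤ B)
    (hD : ∀ y < N, D y = if y = src then 1 else 0) (hrank : ∀ y < N, rank y = 0)
    (hpar : par src = src) : DijkstraInv sz B N src w N D rank par where
  nonneg y hy := by rw [hD y hy]; split_ifs <;> simp
  le_one y hy := by rw [hD y hy]; split_ifs <;> simp
  src_eq := by rw [hD src hsrc, if_pos rfl]
  par_src := hpar
  card := by
    rw [Finset.filter_false_of_mem (fun y hy => by simp [hrank y (Finset.mem_range.1 hy)])]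
    simp
  rank_le y hy := by simp [hrank y hy]
  lt_rank y hy h := absurd (hrank y hy) h
  open_le x hx y hy h := absurd (hrank x hx) h
  relaxed x hx y hy h := absurd (hrank x hx) h
  parent y hy hne h := by rw [hD y hy, if_neg hne] at h; exact absurd h (lt_irrefl _)
  size_le y hy := by
    rw [hD y hy, Nat.add_mul]
    split_ifs <;> omega

/-- Since `w x y ≤ 1`, no value offered through `x` exceeds `D x`, while every closed node has value
at least `D x`. So relaxing changes open nodes only, and the facts about closed nodes persist. -/
theorem DijkstraInv.step (hw1 : ∀ x y, w x y ≤ 1)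
    (hsz : ∀ a b, sz (a * b) ≤ sz a + sz b) (hwB : ∀ x y, sz (w x y) ≤ B)
    (h : DijkstraInv sz B N src w (r + 1) D rank par) {x : ℕ} (hx : x < N) (hxo : rank x = 0)
    (hmax : ∀ y < N, rank y = 0 → D y ≤ D x) {D' : ℕ → K} {rank' par' : ℕ → ℕ} (hsrc : src < N)
    (hD : ∀ y < N, D' y = if D x * w x y ≤ D y then D y else D x * w x y)
    (hpar : ∀ y < N, par' y = if D x * w x y ≤ D y then par y else x)
    (hrank : ∀ y < N, rank' y = if y = x then r + 1 else rank y) :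
    DijkstraInv sz B N src w r D' rank' par' := by
  have hxw : ∀ y < N, D x * w x y ≤ D x := fun y _ =>
    mul_le_of_le_one_right (h.nonneg x hx) (hw1 x y)
  have hle : ∀ y < N, D y ≤ D' y := by
    intro y hy
    rw [hD y hy]
    split_ifs with hc
    · exact le_rfl
    · exact (not_le.1 hc).le
  have hclosed : ∀ y < N, (rank y ≠ 0 ∨ y = x) → D x * w x y ≤ D y := by
    rintro y hy (hc | rfl)
    · exact (hxw y hy).trans (h.open_le y hy x hx hc hxo)
    · exact hxw y hy
  have hDc : ∀ y < N, (rank y ≠ 0 ∨ y = x) → D' y = D y := fun y hy hc => by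
    rw [hD y hy, if_pos (hclosed y hy hc)]
  have hrank' : ∀ y < N, rank' y ≠ 0 → (rank y ≠ 0 ∨ y = x) := by
    intro y hy hc
    rw [hrank y hy] at hc
    split_ifs at hc with he
    · exact .inr he
    · exact .inl hc
  have hsrc1 : D x * w x src ≤ D src := by
    rw [h.src_eq]; exact (hxw src hsrc).trans (h.le_one x hx)
  refine ⟨fun y hy => (h.nonneg y hy).trans (hle y hy), fun y hy => ?_, ?_, ?_, ?_, fun y hy => ?_,
    fun y hy hc => ?_, fun x' hx' y hy hc ho => ?_, fun x' hx' y hy hc => ?_,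
    fun y hy hne hpos => ?_, fun y hy => ?_⟩
  · rw [hD y hy]
    split_ifs
    · exact h.le_one y hy
    · exact (hxw y hy).trans (h.le_one x hx)
  · rw [hD src hsrc, if_pos hsrc1, h.src_eq]
  · rw [hpar src hsrc, if_pos hsrc1, h.par_src]
  · have e : ((Finset.range N).filter fun y => rank' y ≠ 0) =
        insert x ((Finset.range N).filter fun y => rank y ≠ 0) := by
      ext y
      simp only [Finset.mem_filter, Finset.mem_range, Finset.mem_insert]
      constructor
      · rintro ⟨hy, hc⟩
        rcases hrank' y hy hc with h1 | h1
        · exact .inr ⟨hy, h1⟩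
        · exact .inl h1
      · rintro (rfl | ⟨hy, hc⟩)
        · exact ⟨hx, by rw [hrank y hx, if_pos rfl]; omega⟩
        · exact ⟨hy, by rw [hrank y hy]; split_ifs <;> omega⟩
    rw [e, Finset.card_insert_of_notMem (by simp [hxo])]
    have := h.card
    omega
  · rw [hrank y hy]
    have := h.card
    have := h.rank_le y hy
    split_ifs <;> omega
  · rw [hrank y hy] at hc ⊢
    have := h.lt_rank y hy
    split_ifs at hc ⊢ <;> omega
  · have hc' := hrank' x' hx' hc
    rw [hrank y hy] at ho
    split_ifs at ho with hyx
    rw [hDc x' hx' hc', hD y hy]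
    have key : D y ≤ D x' ∧ D x ≤ D x' := by
      rcases hc' with h1 | rfl
      · exact ⟨h.open_le x' hx' y hy h1 ho, h.open_le x' hx' x hx h1 hxo⟩
      · exact ⟨hmax y hy ho, le_rfl⟩
    split_ifs
    · exact key.1
    · exact (hxw y hy).trans key.2
  · have hc' := hrank' x' hx' hc
    rw [hDc x' hx' hc']
    rcases hc' with h1 | rfl
    · exact (h.relaxed x' hx' y hy h1).trans (hle y hy)
    · rw [hD y hy]
      split_ifs with h2
      · exact h2
      · exact le_rfl
  · rw [hpar y hy]
    by_cases hc : D x * w x y ≤ D y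
    · rw [if_pos hc]
      rw [hD y hy, if_pos hc] at hpos ⊢
      obtain ⟨h1, h2, h3⟩ := h.parent y hy hne hpos
      -- A predecessor outranks its successor, so it is already closed and differs from the open
      -- node `x`.
      have h4 : rank (par y) ≠ 0 := by omega
      have h5 : par y ≠ x := fun h6 => h4 (h6 ▸ hxo)
      refine ⟨h1, ?_, ?_⟩
      · rw [hrank y hy, hrank _ h1, if_neg h5]
        have := h.lt_rank _ h1 h4
        split_ifs <;> omega
      · rw [hDc _ h1 (.inl h4)]
        exact h3
    · rw [if_neg hc]
      have hop : ¬ (rank y ≠ 0 ∨ y = x) := fun h1 => hc (hclosed y hy h1)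
      push Not at hop
      refine ⟨hx, ?_, ?_⟩
      · rw [hrank y hy, hrank x hx, if_neg hop.2, if_pos rfl]
        omega
      · rw [hDc x hx (.inr rfl), hD y hy, if_neg hc]
  · rw [hD y hy]
    have h1 := h.size_le y hy
    have h2 := h.size_le x hx
    have h3 := hsz (D x) (w x y)
    have h4 := hwB x y
    rw [Nat.add_mul] at h1 h2
    split_ifs <;> omega

end Dijkstra

/-! ### Paths -/

namespace UncertainGraph

variable {K V : Type} [Field K] [LinearOrder K]

theorem pathProb_singleton (G : UncertainGraph K V) (u : V) : G.pathProb [u] = 1 := by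
  simp [pathProb]

theorem pathProb_cons_cons (G : UncertainGraph K V) (u v : V) (l : List V) :
    G.pathProb (u :: v :: l) = G.p (u, v) * G.pathProb (v :: l) := by
  simp [pathProb]

theorem pathProb_append_cons (G : UncertainGraph K V) (l l' : List V) (v : V) :
    G.pathProb (l ++ v :: l') = G.pathProb (l ++ [v]) * G.pathProb (v :: l') := by
  induction l with
  | nil => simp [pathProb_singleton]
  | cons u l ih =>
    cases l with
    | nil => simp [pathProb_cons_cons, pathProb_singleton]
    | cons w l =>
      simp only [List.cons_append, pathProb_cons_cons] at ih ⊢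
      rw [ih, mul_assoc]

variable [IsStrictOrderedRing K]

theorem pathProb_nonneg_le_one (G : UncertainGraph K V) {l : List V}
    (h : l.IsChain (fun u v => (u, v) ∈ G.edges)) : 0 ≤ G.pathProb l ∧ G.pathProb l ≤ 1 := by
  induction l with
  | nil => simp [pathProb]
  | cons u l ih =>
    cases l with
    | nil => simp [pathProb_singleton]
    | cons v l =>
      rw [List.isChain_cons_cons] at h
      obtain ⟨h1, h2⟩ := ih h.2
      obtain ⟨h3, h4⟩ := G.p_mem _ h.1
      rw [pathProb_cons_cons]
      exact ⟨mul_nonneg h3 h1, mul_le_one₀ h4 h1 h2⟩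

/-- If `v` already lies on the path, cut the path back to `v`: the factors dropped are at most `1`.
Otherwise append `v`. This turns walks into simple paths step by step. -/
theorem IsPath.extend {G : UncertainGraph K V} {s u v : V} {l : List V} (h : G.IsPath s u l)
    (huv : (u, v) ∈ G.edges) :
    ∃ l', G.IsPath s v l' ∧ G.pathProb l * G.p (u, v) ≤ G.pathProb l' := by
  classical
  obtain ⟨h1, h2, h3, h4⟩ := h
  obtain ⟨hp0, hp1⟩ := G.p_mem _ huv
  have hl := G.pathProb_nonneg_le_one h4
  by_cases hv : v ∈ l
  · obtain ⟨a, b, rfl⟩ := List.append_of_mem hv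
    have e : a ++ v :: b = (a ++ [v]) ++ b := by simp
    refine ⟨a ++ [v], ⟨?_, by simp, ?_, ?_⟩, ?_⟩
    · cases a <;> simpa using h1
    · rw [e] at h3; exact (List.nodup_append.1 h3).1
    · rw [e] at h4; exact (List.isChain_append.1 h4).1
    · have ha : (a ++ [v]).IsChain (fun u v => (u, v) ∈ G.edges) := by
        rw [e] at h4; exact (List.isChain_append.1 h4).1
      have hb : (v :: b).IsChain (fun u v => (u, v) ∈ G.edges) := (List.isChain_append.1 h4).2.1
      refine (mul_le_of_le_one_right hl.1 hp1).trans ?_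
      rw [pathProb_append_cons]
      exact mul_le_of_le_one_right (G.pathProb_nonneg_le_one ha).1 (G.pathProb_nonneg_le_one hb).2
  · obtain ⟨a, rfl⟩ : ∃ a, l = a ++ [u] := by
      obtain ⟨a, ha⟩ := List.getLast?_eq_some_iff.1 h2
      exact ⟨a, ha⟩
    refine ⟨a ++ [u] ++ [v], ⟨?_, by simp, ?_, ?_⟩, ?_⟩
    · cases a <;> simpa using h1
    · rw [List.nodup_append]
      refine ⟨h3, by simp, ?_⟩
      intro x hx y hy hxy
      rw [List.mem_singleton.1 hy] at hxy
      exact hv (hxy ▸ hx)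
    · rw [List.isChain_append]
      refine ⟨h4, by simp, ?_⟩
      intro x hx y hy
      simp at hx hy
      rw [← hx, ← hy]
      exact huv
    · rw [List.append_assoc, List.singleton_append, G.pathProb_append_cons a [v] u,
        pathProb_cons_cons, pathProb_singleton, mul_one]

omit [IsStrictOrderedRing K] in
theorem exists_isMostReliablePath [Fintype V] {G : UncertainGraph K V} {s t : V} {l : List V}
    (h : G.IsPath s t l) : ∃ P, G.IsMostReliablePath s t P := by
  have hfin : {l | G.IsPath s t l}.Finite := by
    refine (List.finite_length_le V (Fintype.card V)).subset ?_
    intro l hl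
    exact hl.2.2.1.length_le_card
  obtain ⟨P, hP, hmax⟩ := Set.exists_max_image _ G.pathProb hfin ⟨l, h⟩
  exact ⟨P, hP, hmax⟩

end UncertainGraph

namespace MRPInstance

open UncertainGraph

variable {K : Type} [Field K] [LinearOrder K] {n : ℕ} (I : MRPInstance K n)

/-! ### The layered graph -/

/-- The number of nodes of the layered graph, which consists of the layers `0, …, k`.  The copy of
the node `v` in the layer `i` has the number `i * n + v`. -/
def size : ℕ := (I.k + 1) * n

/-- The edge weights of the layered graph: the edges of the uncertain graph stay inside a layer,
missing edges lead to the next layer, and there one may also stay at the same node. -/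
def weight (x y : ℕ) : K :=
  -- With truncated subtraction this sum is `0` within a layer, `1` exactly when `y` is one layer
  -- above `x`, and at least `2` otherwise. It is the quantity the program computes.
  if (x / n - y / n) + (x / n - y / n) + (y / n - x / n) ≤ 0 then
    I.start.numMem (x % n * n + y % n)
  else if (x / n - y / n) + (x / n - y / n) + (y / n - x / n) ≤ 1 then
    if (x % n - y % n) + (y % n - x % n) ≤ 0 then 1
    else if I.start.mem (x % n * n + y % n) ≤ 0 then I.ζ else 0
  else 0

variable {I}

theorem index_lt {i v k : ℕ} (hi : i ≤ k) (hv : v < n) : i * n + v < (k + 1) * n := by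
  calc i * n + v < i * n + n := by omega
    _ = (i + 1) * n := by ring
    _ ≤ (k + 1) * n := Nat.mul_le_mul_right _ (by omega)

theorem index_div {i v : ℕ} (hv : v < n) : (i * n + v) / n = i := by
  rw [mul_comm, Nat.mul_add_div (by omega), Nat.div_eq_of_lt hv, add_zero]

theorem index_mod {i v : ℕ} (hv : v < n) : (i * n + v) % n = v := by
  rw [mul_comm, Nat.mul_add_mod, Nat.mod_eq_of_lt hv]

theorem symm_index (u v : Fin n) (h : (u : ℕ) * n + v < n * n) :
    finProdFinEquiv.symm ⟨(u : ℕ) * n + v, h⟩ = (u, v) := by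
  rw [Equiv.symm_apply_eq]
  ext
  simp [finProdFinEquiv]
  ring

theorem square_index_lt (u v : Fin n) : (u : ℕ) * n + v < n * n := by
  have := index_lt (n := n) (i := u) (v := v) (k := n - 1) (by omega) v.2
  rwa [Nat.sub_add_cancel (by omega)] at this

theorem start_mem (u v : Fin n) :
    I.start.mem (u * n + v) = if (u, v) ∈ I.G.edges then 1 else 0 := by
  have h := square_index_lt u v
  simp only [start, h, dif_pos, symm_index]

theorem start_numMem (u v : Fin n) : I.start.numMem (u * n + v) = I.entry (u, v) := by
  have h := square_index_lt u v
  simp only [start, h, dif_pos, symm_index]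

theorem weight_same (i : ℕ) (u v : Fin n) :
    I.weight (i * n + u) (i * n + v) = I.entry (u, v) := by
  simp only [weight, index_div u.2, index_div v.2, index_mod u.2, index_mod v.2, start_numMem]
  simp

theorem weight_next (i : ℕ) (u v : Fin n) :
    I.weight (i * n + u) ((i + 1) * n + v) =
      if u = v then 1 else if (u, v) ∈ I.G.edges then 0 else I.ζ := by
  simp only [weight, index_div u.2, index_div v.2, index_mod u.2, index_mod v.2, start_mem]
  rw [if_neg (by omega), if_pos (by omega)]
  by_cases h : u = v
  · subst h; simp
  · have h' : (u : ℕ) ≠ v := fun h1 => h (Fin.ext h1)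
    rw [if_neg (by omega), if_neg h]
    split_ifs <;> simp_all

theorem weight_other {x y : ℕ} (h : y / n ≠ x / n) (h' : y / n ≠ x / n + 1) :
    I.weight x y = 0 := by
  rw [weight, if_neg (by omega), if_neg (by omega)]

variable [IsStrictOrderedRing K]

theorem entry_mem (I : MRPInstance K n) (e : Fin n × Fin n) : 0 ≤ I.entry e ∧ I.entry e ≤ 1 := by
  rw [entry]
  split_ifs with h
  · exact I.G.p_mem e h
  · simp

theorem start_numMem_mem (I : MRPInstance K n) (a : ℕ) :
    0 ≤ I.start.numMem a ∧ I.start.numMem a ≤ 1 := by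
  simp only [start]
  split_ifs
  · exact I.entry_mem _
  · simp

theorem weight_mem (I : MRPInstance K n) (x y : ℕ) : 0 ≤ I.weight x y ∧ I.weight x y ≤ 1 := by
  have := I.hζ
  rw [weight]
  split_ifs
  · exact I.start_numMem_mem _
  · simp
  · exact ⟨this.1.le, this.2⟩
  · simp
  · simp

/-! ### Upper bound: lifting paths to the layered graph -/

/-- The number of edges of the path `l` that belong to `E`. -/
def newEdges (E : Finset (Fin n × Fin n)) (l : List (Fin n)) : ℕ :=
  (l.zip l.tail).countP (· ∈ E)

omit [IsStrictOrderedRing K] in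
-- The edges of a simple path have distinct end nodes, so none is counted twice.
theorem newEdges_le {E : Finset (Fin n × Fin n)} {l : List (Fin n)} (h : l.Nodup) :
    newEdges E l ≤ E.card := by
  have h1 : (l.zip l.tail).Nodup := by
    apply List.Nodup.of_map Prod.snd
    rw [List.map_snd_zip (by simp)]
    exact h.tail
  rw [newEdges, List.countP_eq_length_filter, ← List.toFinset_card_of_nodup (h1.filter _)]
  apply Finset.card_le_card
  intro e he
  simp at he
  exact he.2

/-- The values of the closed layered graph bound the probabilities of paths. -/
theorem mul_pathProb_le {D : ℕ → K} (h0 : ∀ x < I.size, 0 ≤ D x)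
    (hD : ∀ x < I.size, ∀ y < I.size, D x * I.weight x y ≤ D y)
    {E : Finset (Fin n × Fin n)} (hE : E ⊆ I.G.edgesᶜ) {l : List (Fin n)} :
    ∀ {u v : Fin n} {i : ℕ}, l.head? = some u → l.getLast? = some v →
      l.IsChain (fun u v => (u, v) ∈ (I.updated E).edges) → i + newEdges E l ≤ I.k →
      D (i * n + u) * (I.updated E).pathProb l ≤ D ((i + newEdges E l) * n + v) := by
  induction l with
  | nil => simp
  | cons a l ih =>
    intro u v i hu hv hl hi
    obtain rfl : a = u := by simpa using hu
    cases l with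
    | nil =>
      obtain rfl : a = v := by simpa using hv
      simp [newEdges, pathProb_singleton]
    | cons b l =>
      rw [List.isChain_cons_cons] at hl
      rw [pathProb_cons_cons, ← mul_assoc]
      have hbl := ((I.updated E).pathProb_nonneg_le_one hl.2).1
      have hv' : (b :: l).getLast? = some v := by simpa using hv
      have hcount : newEdges E (a :: b :: l) =
          newEdges E (b :: l) + if (a, b) ∈ E then 1 else 0 := by
        simp [newEdges, List.countP_cons]
      by_cases hab : (a, b) ∈ E
      · rw [if_pos hab] at hcount
        have h1 := ih (i := i + 1) (u := b) rfl hv' hl.2 (by omega)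
        rw [hcount, show i + (newEdges E (b :: l) + 1) = i + 1 + newEdges E (b :: l) by ring]
        refine (mul_le_mul_of_nonneg_right ?_ hbl).trans h1
        have hp : (I.updated E).p (a, b) = I.ζ := by simp [updated, addEdges, hab]
        rw [hp]
        refine (mul_le_mul_of_nonneg_left ?_ (h0 _ (index_lt (by omega) a.2))).trans
          (hD _ (index_lt (by omega) a.2) _ (index_lt (by omega) b.2))
        rw [weight_next]
        have hnot : (a, b) ∉ I.G.edges := Finset.mem_compl.1 (hE hab)
        rw [if_neg hnot]
        -- For a new loop, the step to the next copy of the node has weight `1 ≥ ζ`.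
        split_ifs
        · exact I.hζ.2
        · exact le_rfl
      · rw [if_neg hab, add_zero] at hcount
        have h1 := ih (i := i) (u := b) rfl hv' hl.2 (by omega)
        rw [hcount]
        refine (mul_le_mul_of_nonneg_right ?_ hbl).trans h1
        have hab' : (a, b) ∈ I.G.edges := by
          rcases Finset.mem_union.1 hl.1 with h2 | h2
          · exact h2
          · exact absurd h2 hab
        have hp : (I.updated E).p (a, b) = I.weight (i * n + a) (i * n + b) := by
          rw [weight_same]
          simp [updated, addEdges, hab, entry, hab']
        rw [hp]
        exact hD _ (index_lt (by omega) a.2) _ (index_lt (by omega) b.2)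

omit [IsStrictOrderedRing K] in
-- Moving up at the same node has weight `1`; thus paths with fewer than `k` new edges are also
-- compared with the value in layer `k`.
theorem layer_mono {D : ℕ → K}
    (hD : ∀ x < I.size, ∀ y < I.size, D x * I.weight x y ≤ D y) (v : Fin n) {i j : ℕ}
    (hij : i ≤ j) (hj : j ≤ I.k) : D (i * n + v) ≤ D (j * n + v) := by
  induction j, hij using Nat.le_induction with
  | base => exact le_rfl
  | succ j hij ih =>
    refine (ih (by omega)).trans ?_
    have := hD _ (index_lt (i := j) (by omega) v.2) _ (index_lt (i := j + 1) hj v.2)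
    rwa [weight_next, if_pos rfl, mul_one] at this

theorem pathProb_le {D : ℕ → K} (h0 : ∀ x < I.size, 0 ≤ D x) (hs : D I.s = 1)
    (hD : ∀ x < I.size, ∀ y < I.size, D x * I.weight x y ≤ D y)
    {E : Finset (Fin n × Fin n)} (hE : I.IsFeasible E) {l : List (Fin n)}
    (hl : (I.updated E).IsPath I.s I.t l) :
    (I.updated E).pathProb l ≤ D (I.k * n + I.t) := by
  obtain ⟨h1, h2, h3, h4⟩ := hl
  have hc : newEdges E l ≤ I.k := hE.2 ▸ newEdges_le h3
  have := mul_pathProb_le h0 hD hE.1 (i := 0) h1 h2 h4 (by omega)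
  simp only [zero_mul, zero_add, hs, one_mul] at this
  exact this.trans (layer_mono hD _ hc le_rfl)

/-- An optimality certificate: `D` bounds the paths of every feasible set, so one path reaching the
bound suffices. -/
theorem IsFeasible.isSolution {E : Finset (Fin n × Fin n)} (hE : I.IsFeasible E) {D : ℕ → K}
    (h0 : ∀ x < I.size, 0 ≤ D x) (hs : D I.s = 1)
    (hD : ∀ x < I.size, ∀ y < I.size, D x * I.weight x y ≤ D y)
    (hl : ∃ l, (I.updated E).IsPath I.s I.t l ∧ D (I.k * n + I.t) ≤ (I.updated E).pathProb l) :
    I.IsSolution E := by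
  obtain ⟨l, hl, hle⟩ := hl
  obtain ⟨P, hP⟩ := exists_isMostReliablePath hl
  exact ⟨hE, P, hP, fun E₂ hE₂ Q hQ =>
    (pathProb_le h0 hs hD hE₂ hQ.1).trans (hle.trans (hP.2 l hl))⟩

/-! ### Attaining the bound -/

/-- If the target has value `0`, then there is an edge from the source to the target. -/
theorem exists_path_of_le_zero {D : ℕ → K} (hs : D I.s = 1)
    (hD : ∀ x < I.size, ∀ y < I.size, D x * I.weight x y ≤ D y)
    {E : Finset (Fin n × Fin n)} (h : D (I.k * n + I.t) ≤ 0) :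
    ∃ l, (I.updated E).IsPath I.s I.t l ∧ D (I.k * n + I.t) ≤ (I.updated E).pathProb l := by
  have hk := I.k_pos
  -- The step from `s` to `t` into layer `1` would have weight `1` if `s = t` and `ζ` if the edge
  -- were missing. Both are positive, so `(s, t)` must be an edge.
  have h1 := hD _ (index_lt (i := 0) (by omega) I.s.2) _ (index_lt (i := 1) hk I.t.2)
  rw [← zero_add 1, weight_next, zero_add, zero_mul, zero_add, hs, one_mul] at h1
  have h2 := h1.trans ((layer_mono hD I.t hk le_rfl).trans h)
  have hζ := I.hζ.1
  have hne : I.s ≠ I.t := by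
    intro he
    rw [if_pos he] at h2
    exact absurd h2 (not_le.2 one_pos)
  rw [if_neg hne] at h2
  have hmem : (I.s, I.t) ∈ I.G.edges := by
    by_contra hn
    rw [if_neg hn] at h2
    exact absurd h2 (not_le.2 hζ)
  have hpath : (I.updated E).IsPath I.s I.t [I.s, I.t] := by
    refine ⟨rfl, rfl, by simpa using hne, ?_⟩
    simp [updated, addEdges, hmem]
  exact ⟨_, hpath, h.trans ((I.updated E).pathProb_nonneg_le_one hpath.2.2.2).1⟩

/-- In the layered graph, `y` is a predecessor of `x` on an optimal path, and if this uses a new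
edge, then that edge is marked by `2` in `m`. -/
def Link (I : MRPInstance K n) (D : ℕ → K) (m : ℕ → ℕ) (y x : ℕ) : Prop :=
  y < I.size ∧ x < I.size ∧ 0 < D x ∧ D x = D y * I.weight y x ∧
    (y / n + 1 ≤ x / n → I.start.mem (y % n * n + x % n) = 0 → m (y % n * n + x % n) = 2)

/-- Positive values force positive weights along the links. So each step follows an existing edge,
stays at its node, or uses a missing edge, which is marked and hence in `E`. An inequality is all
that survives the removal of cycles. -/
theorem exists_path_of_link {D : ℕ → K} {m : ℕ → ℕ} (hs : D I.s = 1) {E : Finset (Fin n × Fin n)}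
    (hE : E ⊆ I.G.edgesᶜ) (hm : ∀ u v : Fin n, m (u * n + v) = 2 → (u, v) ∈ E)
    {x : ℕ} (h : Relation.ReflTransGen (I.Link D m) I.s x) (v : Fin n) (hv : x % n = v) :
    ∃ l, (I.updated E).IsPath I.s v l ∧ D x ≤ (I.updated E).pathProb l := by
  have hn : 0 < n := I.s.pos
  induction h generalizing v with
  | refl =>
    rw [Nat.mod_eq_of_lt I.s.2] at hv
    obtain rfl : I.s = v := Fin.ext hv
    exact ⟨[I.s], ⟨rfl, rfl, by simp, by simp⟩, by rw [hs, pathProb_singleton]⟩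
  | @tail y x _ hyx ih =>
    obtain ⟨hy, hx, hpos, hDx, hmark⟩ := hyx
    obtain ⟨l, hl, hle⟩ := ih ⟨y % n, Nat.mod_lt _ hn⟩ rfl
    have hwpos : 0 < I.weight y x := by
      refine lt_of_le_of_ne (I.weight_mem y x).1 fun hz => ?_
      rw [← hz, mul_zero] at hDx
      exact hpos.ne' hDx
    set u : Fin n := ⟨y % n, Nat.mod_lt _ hn⟩ with hu
    have ey : y = y / n * n + u := (Nat.div_add_mod' y n).symm
    have ex : x = x / n * n + v := by rw [← hv]; exact (Nat.div_add_mod' x n).symm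
    have key : ∀ c, (u, v) ∈ (I.updated E).edges → (I.updated E).p (u, v) = c →
        I.weight y x = c → ∃ l, (I.updated E).IsPath I.s v l ∧ D x ≤ (I.updated E).pathProb l := by
      rintro c h1 h2 h3
      obtain ⟨l', hl', hle'⟩ := hl.extend h1
      refine ⟨l', hl', le_trans ?_ hle'⟩
      rw [hDx, h3, ← h2]
      exact mul_le_mul_of_nonneg_right hle ((I.updated E).p_mem _ h1).1
    by_cases h1 : x / n = y / n
    · have hw : I.weight y x = I.entry (u, v) := by
        rw [ey, ex, h1, weight_same]
      have hmem : (u, v) ∈ I.G.edges := by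
        by_contra hc
        rw [hw, entry, if_neg hc] at hwpos
        exact lt_irrefl _ hwpos
      have hnE : (u, v) ∉ E := fun hc => Finset.mem_compl.1 (hE hc) hmem
      refine key _ (Finset.mem_union_left _ hmem) ?_ hw
      simp [updated, addEdges, hnE, entry, hmem]
    · by_cases h2 : x / n = y / n + 1
      · have hw : I.weight y x = if u = v then 1 else if (u, v) ∈ I.G.edges then 0 else I.ζ := by
          rw [ey, ex, h2, weight_next]
        by_cases huv : u = v
        · refine ⟨l, huv ▸ hl, ?_⟩
          rw [hDx, hw, if_pos huv, mul_one]
          exact hle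
        · rw [if_neg huv] at hw
          have hnmem : (u, v) ∉ I.G.edges := by
            intro hc
            rw [hw, if_pos hc] at hwpos
            exact lt_irrefl _ hwpos
          rw [if_neg hnmem] at hw
          have hmem : (u, v) ∈ E := by
            apply hm
            have := hmark (by omega)
            rw [hv, show y % n = u from rfl] at this
            exact this (by rw [start_mem, if_neg hnmem])
          refine key _ (Finset.mem_union_right _ hmem) ?_ hw
          simp [updated, addEdges, hmem]
      · rw [weight_other h1 h2] at hwpos
        exact absurd hwpos (lt_irrefl _)

end MRPInstance

/-! ### The program -/

namespace RAM

/-- Computes in number register `2` the weight of the edge of the layered graph from the copy of the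
node `reg 23` in the layer `reg 22` to the node with the number `reg 25`. -/
def weightCmd : Cmd := .block
  [.op (.add 20 8 25), .op (.load 26 20), .op (.add 20 9 25), .op (.load 27 20),
    .op (.add 28 24 27),
    .op (.sub 20 22 26), .op (.add 20 20 20), .op (.sub 21 26 22), .op (.add 20 20 21),
    .ite (.le 20 10) (.op (.numLoad 2 28))
      (.ite (.le 20 4)
        (.block [.op (.sub 20 23 27), .op (.sub 21 27 23), .op (.add 20 20 21),
          .ite (.le 20 10) (.op (.numMove 2 5))
            (.block [.op (.load 21 28),
              .ite (.le 21 10) (.op (.numMove 2 0)) (.op (.numMove 2 4))])])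
        (.op (.numMove 2 4)))]

/-- Updates the value and the predecessor of the node `reg 25`, with the weight in number register
`2` and the closed node `reg 18` of the value `num 1`. -/
def updateCmd : Cmd := .block
  [.op (.numMul 2 1 2), .op (.add 20 6 25), .op (.numLoad 3 20),
    .ite (.numLe 2 3) .skip (.block [.op (.numStore 20 2), .op (.add 20 7 25), .op (.store 20 18)])]

/-- Compares the node `reg 17` with the best open node found so far. -/
def selectCmd : Cmd := .block
  [.op (.add 20 6 17), .op (.load 21 20),
    .ite (.le 21 10)
      (.block [.op (.numLoad 3 20),
        .ite (.numLe 1 3) (.block [.op (.numMove 1 3), .op (.move 18 17)]) .skip])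
      .skip]

/-- Prepares the search for an open node. -/
def openCmd : Cmd := .block [.op (.numMove 1 4), .op (.move 17 5)]

/-- Closes the node `reg 18`. -/
def closeCmd : Cmd := .block
  [.op (.add 20 6 18), .op (.add 21 16 4), .op (.store 20 21), .op (.add 20 8 18),
    .op (.load 22 20), .op (.add 20 9 18), .op (.load 23 20), .op (.mul 24 23 0), .op (.move 25 5)]

/-- One iteration of Dijkstra's algorithm. -/
def dijkstraCmd : Cmd :=
  .seq openCmd (.seq (.down 17 selectCmd)
    (.seq closeCmd (.down 25 (.seq weightCmd updateCmd))))

/-- Computes the constants. -/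
def initCmd : Cmd := .block
  [.op (.const 4 1), .op (.add 5 1 4), .op (.move 13 5), .op (.mul 5 5 0), .op (.mul 6 0 0),
    .op (.add 7 6 5), .op (.add 8 7 5), .op (.add 9 8 5), .op (.numOne 5), .op (.move 12 5)]

/-- Writes the layer and the underlying node of the node `reg 12` of the layered graph. -/
def decodeCmd : Cmd := .block
  [.ite (.le 4 14) .skip (.block [.op (.sub 13 13 4), .op (.move 14 0)]), .op (.sub 14 14 4),
    .op (.add 15 8 12), .op (.store 15 13), .op (.add 15 9 12), .op (.store 15 14)]

/-- Initializes Dijkstra's algorithm. -/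
def sourceCmd : Cmd := .block
  [.op (.add 11 6 2), .op (.numStore 11 5), .op (.add 11 7 2), .op (.store 11 2), .op (.move 16 5)]

/-- Starts tracing back an optimal path. -/
def targetCmd : Cmd := .block
  [.op (.mul 12 1 0), .op (.add 12 12 3), .op (.add 20 6 12), .op (.numLoad 1 20),
    .ite (.numLe 1 4) (.op (.move 12 2)) .skip, .op (.const 13 0), .op (.move 16 5)]

/-- Traces back one edge, and marks it if it is new. -/
def traceCmd : Cmd := .block
  [.op (.add 20 7 12), .op (.load 17 20), .op (.add 20 8 12), .op (.load 21 20),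
    .op (.add 20 8 17), .op (.load 22 20), .op (.add 22 22 4),
    .ite (.le 22 21)
      (.block [.op (.add 20 9 17), .op (.load 23 20), .op (.mul 23 23 0), .op (.add 20 9 12),
        .op (.load 24 20), .op (.add 23 23 24), .op (.load 24 23),
        .ite (.le 24 10)
          (.block [.op (.const 24 2), .op (.store 23 24), .op (.add 13 13 4)]) .skip])
      .skip,
    .op (.move 12 17)]

/-- Turns the marked adjacency matrix into the output, using up the remaining budget. -/
def fillCmd : Cmd := .block
  [.op (.load 20 12),
    .ite (.le 4 20) (.block [.op (.sub 20 20 4), .op (.store 12 20)])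
      (.block [.op (.add 21 13 4),
        .ite (.le 21 1) (.block [.op (.store 12 4), .op (.move 13 21)]) .skip])]

/-- The program solving the most-reliable-path improvement problem. -/
def improveCmd : Cmd :=
  .seq initCmd (.seq (.down 12 decodeCmd) (.seq sourceCmd (.seq (.down 16 dijkstraCmd)
    (.seq targetCmd (.seq (.down 16 traceCmd) (.seq (.op (.move 12 6)) (.down 12 fillCmd)))))))

end RAM

/-! ### Verification -/

namespace MRPInstance

open RAM

variable {K : Type} [Field K] [LinearOrder K] {n : ℕ} {I : MRPInstance K n}
  {sz : K → ℕ} {B W S : ℕ}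

/-- The registers containing constants. -/
structure Ready (I : MRPInstance K n) (σ : State K) : Prop where
  r0 : σ.reg 0 = n
  r1 : σ.reg 1 = I.k
  r2 : σ.reg 2 = I.s
  r3 : σ.reg 3 = I.t
  r4 : σ.reg 4 = 1
  r5 : σ.reg 5 = I.size
  r6 : σ.reg 6 = n * n
  r7 : σ.reg 7 = n * n + I.size
  r8 : σ.reg 8 = n * n + I.size + I.size
  r9 : σ.reg 9 = n * n + I.size + I.size + I.size
  r10 : σ.reg 10 = 0
  n0 : σ.num 0 = I.ζ
  n4 : σ.num 4 = 0
  n5 : σ.num 5 = 1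

theorem Ready.congr {σ τ : State K} (h : I.Ready σ) (hr : ∀ r < 11, τ.reg r = σ.reg r)
    (h0 : τ.num 0 = σ.num 0) (h4 : τ.num 4 = σ.num 4) (h5 : τ.num 5 = σ.num 5) : I.Ready τ := by
  constructor
  case n0 => rw [h0, h.n0]
  case n4 => rw [h4, h.n4]
  case n5 => rw [h5, h.n5]
  all_goals rw [hr _ (by norm_num)]
  exacts [h.r0, h.r1, h.r2, h.r3, h.r4, h.r5, h.r6, h.r7, h.r8, h.r9, h.r10]

/-- The tables in the memory that do not change during Dijkstra's algorithm: the input, and the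
layers and the underlying nodes of the nodes of the layered graph. -/
structure Tables (I : MRPInstance K n) (m : ℕ → ℕ) (q : ℕ → K) : Prop where
  adj : ∀ a < n * n, m a = I.start.mem a
  prob : ∀ a < n * n, q a = I.start.numMem a
  layer : ∀ x < I.size, m (n * n + I.size + I.size + x) = x / n
  node : ∀ x < I.size, m (n * n + I.size + I.size + I.size + x) = x % n

theorem Tables.congr {m m' : ℕ → ℕ} {q q' : ℕ → K} (h : I.Tables m q)
    (hm : ∀ a, a < n * n ∨ n * n + I.size + I.size ≤ a → m' a = m a)
    (hq : ∀ a < n * n, q' a = q a) : I.Tables m' q' where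
  adj a ha := by rw [hm a (.inl ha), h.adj a ha]
  prob a ha := by rw [hq a ha, h.prob a ha]
  layer x hx := by rw [hm _ (.inr (by omega)), h.layer x hx]
  node x hx := by rw [hm _ (.inr (by omega)), h.node x hx]

theorem n_pos (I : MRPInstance K n) : 0 < n := I.s.pos

theorem div_le {x : ℕ} (h : x < I.size) : x / n ≤ I.k :=
  Nat.lt_succ_iff.1 ((Nat.div_lt_iff_lt_mul I.n_pos).2 h)

theorem mod_lt (I : MRPInstance K n) (x : ℕ) : x % n < n := Nat.mod_lt _ I.n_pos

theorem mod_index_lt (I : MRPInstance K n) (x y : ℕ) : x % n * n + y % n < n * n :=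
  square_index_lt ⟨x % n, I.mod_lt x⟩ ⟨y % n, I.mod_lt y⟩

theorem le_size (I : MRPInstance K n) : n ≤ I.size := Nat.le_mul_of_pos_left _ (by omega)

theorem weightCmd_runs (hW : n * n + 4 * I.size + 3 * I.k + 3 ≤ W) {σ : State K} {x y : ℕ}
    (hσ : I.Ready σ) (ht : I.Tables σ.mem σ.numMem) (hx : x < I.size) (hy : y < I.size)
    (h22 : σ.reg 22 = x / n) (h23 : σ.reg 23 = x % n) (h24 : σ.reg 24 = x % n * n)
    (h25 : σ.reg 25 = y) :
    Runs sz W S weightCmd σ weightCmd.steps fun τ =>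
      τ.num 2 = I.weight x y ∧ (∀ r, r ≠ 2 → τ.num r = σ.num r) ∧ τ.mem = σ.mem ∧
        τ.numMem = σ.numMem ∧ ∀ r < 26, r ≠ 20 → r ≠ 21 → τ.reg r = σ.reg r := by
  apply Runs.of_wp
  have e1 := div_le hx
  have e2 := div_le hy
  have e3 := I.mod_lt x
  have e4 := I.mod_lt y
  have e5 := I.mod_index_lt x y
  have e6 := I.le_size
  have e7 := (Nat.sub_le (x / n) (y / n)).trans e1
  have e8 := (Nat.sub_le (y / n) (x / n)).trans e2
  simp [weightCmd, Cmd.block, Cmd.wp, Op.Fits, Op.Small, Op.run, Test.Holds, hσ.r8, hσ.r9, hσ.r10,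
    hσ.r4, h22, h23, h24, h25, ht.layer y hy, ht.node y hy, hσ.n0, hσ.n4, hσ.n5]
  refine ⟨by omega, by omega, by omega, by omega, by omega, fun h1 h2 => ⟨?_, ?_, ?_⟩, fun h1 =>
    ⟨fun h2 => ⟨by omega, fun h3 h4 => ⟨?_, ?_, ?_⟩, fun h3 => ⟨fun h4 => ⟨?_, ?_, ?_⟩,
      fun h4 => ⟨?_, ?_, ?_⟩⟩⟩, fun h2 => ⟨?_, ?_, ?_⟩⟩⟩
  · rw [weight, if_pos (by omega), ht.prob _ e5]
  rotate_left 2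
  · rw [weight, if_neg (by omega), if_pos (by omega), if_pos (by omega)]
  rotate_left 2
  · rw [weight, if_neg (by omega), if_pos (by omega), if_neg (by omega), if_pos]
    rw [← ht.adj _ e5, h4]
  rotate_left 2
  · rw [weight, if_neg (by omega), if_pos (by omega), if_neg (by omega), if_neg]
    rw [← ht.adj _ e5]
    omega
  rotate_left 2
  · rw [weight, if_neg (by omega), if_neg (by omega)]
  all_goals
    intros
    simp (disch := omega) only [Function.update_of_ne]

/-! ### Relaxing the edges of a closed node -/

/-- The loop invariant for relaxing the edges from the node `x`, where `D`, `rank` and `par` are the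
values before the loop. -/
structure RelaxInv (I : MRPInstance K n) (D : ℕ → K) (rank par : ℕ → ℕ) (x r : ℕ)
    (y : ℕ) (σ : State K) : Prop where
  ready : I.Ready σ
  tables : I.Tables σ.mem σ.numMem
  le : y ≤ I.size
  r16 : σ.reg 16 = r
  r18 : σ.reg 18 = x
  r22 : σ.reg 22 = x / n
  r23 : σ.reg 23 = x % n
  r24 : σ.reg 24 = x % n * n
  r25 : σ.reg 25 = y
  n1 : σ.num 1 = D x
  -- The loop counts down, so the nodes `z < y` still carry their old data, and each comparison is
  -- made against the old value.
  value : ∀ z < I.size, σ.numMem (n * n + z) =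
    if D x * I.weight x z ≤ D z ∨ z < y then D z else D x * I.weight x z
  pred : ∀ z < I.size, σ.mem (n * n + I.size + z) =
    if D x * I.weight x z ≤ D z ∨ z < y then par z else x
  rank_eq : ∀ z < I.size, σ.mem (n * n + z) = rank z

theorem relax_runs (hW : n * n + 4 * I.size + 3 * I.k + 3 ≤ W) {D : ℕ → K} {rank par : ℕ → ℕ}
    {x r : ℕ} (hx : x < I.size) (hS : ∀ y < I.size, sz (D x * I.weight x y) ≤ S)
    (y : ℕ) (σ : State K) (h : I.RelaxInv D rank par x r (y + 1) σ) :
    Runs sz W S (.seq weightCmd updateCmd) { σ with reg := Function.update σ.reg 25 y }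
      (weightCmd.steps + updateCmd.steps) (I.RelaxInv D rank par x r y) := by
  have hy : y < I.size := h.le
  refine (weightCmd_runs (σ := { σ with reg := Function.update σ.reg 25 y }) hW
    (x := x) (y := y) ?_ h.tables hx hy ?_ ?_ ?_ ?_).seq fun τ hτ => ?_
  · exact h.ready.congr (by intro r hr; simp (disch := omega) only [Function.update_of_ne]) rfl rfl rfl
  · simp [h.r22]
  · simp [h.r23]
  · simp [h.r24]
  · simp
  simp only at hτ
  obtain ⟨hw, hnum, hmem, hnumMem, hreg⟩ := hτ
  have hR : I.Ready τ := h.ready.congr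
    (by intro r hr; rw [hreg r (by omega) (by omega) (by omega), Function.update_of_ne (by omega)])
    (hnum _ (by omega)) (hnum _ (by omega)) (hnum _ (by omega))
  have e16 : τ.reg 16 = r := by rw [hreg _ (by omega) (by omega) (by omega), ← h.r16]; rfl
  have e18 : τ.reg 18 = x := by rw [hreg _ (by omega) (by omega) (by omega), ← h.r18]; rfl
  have e22 : τ.reg 22 = x / n := by rw [hreg _ (by omega) (by omega) (by omega), ← h.r22]; rfl
  have e23 : τ.reg 23 = x % n := by rw [hreg _ (by omega) (by omega) (by omega), ← h.r23]; rfl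
  have e24 : τ.reg 24 = x % n * n := by rw [hreg _ (by omega) (by omega) (by omega), ← h.r24]; rfl
  have e25 : τ.reg 25 = y := by rw [hreg _ (by omega) (by omega) (by omega)]; simp
  have e1 : τ.num 1 = D x := by rw [hnum _ (by omega), h.n1]
  have hDy : τ.numMem (n * n + y) = D y := by
    rw [hnumMem, h.value y hy, if_pos (.inr (by omega))]
  apply Runs.of_wp
  simp only [updateCmd, Cmd.block, Cmd.wp, Op.Fits, Op.Small, Op.run, Test.Holds]
  simp [e1, hw, hR.r6, hR.r7, e18, e25, hS y hy, hDy]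
  refine ⟨by omega, fun hc => ?_, fun hc => ⟨by omega, ?_⟩⟩
  · refine ⟨hR.congr (by intro r hr; simp (disch := omega) only [Function.update_of_ne]) (by simp)
      (by simp) (by simp), ?_, hy.le, by simpa using e16, by simpa using e18, by simpa using e22,
      by simpa using e23, by simpa using e24, by simpa using e25, by simpa using e1, ?_, ?_, ?_⟩
    · rw [hmem, hnumMem]; exact h.tables
    · intro z hz
      simp only
      rw [hnumMem, h.value z hz]
      by_cases hzy : z = y
      · subst hzy; simp [hc]
      · simp only [show z < y + 1 ↔ z < y by omega]
    · intro z hz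
      simp only
      rw [hmem, h.pred z hz]
      by_cases hzy : z = y
      · subst hzy; simp [hc]
      · simp only [show z < y + 1 ↔ z < y by omega]
    · intro z hz
      simp only
      rw [hmem, h.rank_eq z hz]
  · refine ⟨hR.congr (by intro r hr; simp (disch := omega) only [Function.update_of_ne]) (by simp)
      (by simp) (by simp), ?_, hy.le, by simpa using e16, by simpa using e18, by simpa using e22,
      by simpa using e23, by simpa using e24, by simpa using e25, by simpa using e1, ?_, ?_, ?_⟩
    · refine h.tables.congr (fun a ha => ?_) (fun a ha => ?_)
      · simp only
        rw [Function.update_of_ne (by omega), hmem]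
      · simp only
        rw [Function.update_of_ne (by omega), hnumMem]
    · intro z hz
      simp only
      by_cases hzy : z = y
      · subst hzy; simp [hc]
      · rw [Function.update_of_ne (by omega), hnumMem, h.value z hz]
        simp only [show z < y + 1 ↔ z < y by omega]
    · intro z hz
      simp only
      by_cases hzy : z = y
      · subst hzy; simp [hc]
      · rw [Function.update_of_ne (by omega), hmem, h.pred z hz]
        simp only [show z < y + 1 ↔ z < y by omega]
    · intro z hz
      simp only
      rw [Function.update_of_ne (by omega), hmem, h.rank_eq z hz]

/-! ### Selecting an open node -/

/-- The loop invariant for the search for an open node of maximal value. -/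
structure SelectInv (I : MRPInstance K n) (σ₀ : State K) (y : ℕ) (σ : State K) : Prop where
  ready : I.Ready σ
  mem_eq : σ.mem = σ₀.mem
  numMem_eq : σ.numMem = σ₀.numMem
  le : y ≤ I.size
  r16 : σ.reg 16 = σ₀.reg 16
  r17 : σ.reg 17 = y
  nonneg : 0 ≤ σ.num 1
  max : ∀ z < I.size, y ≤ z → σ₀.mem (n * n + z) = 0 → σ₀.numMem (n * n + z) ≤ σ.num 1
  found : ((∀ z < I.size, y ≤ z → σ₀.mem (n * n + z) ≠ 0) ∧ σ.num 1 = 0) ∨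
    (σ.reg 18 < I.size ∧ σ₀.mem (n * n + σ.reg 18) = 0 ∧
      σ.num 1 = σ₀.numMem (n * n + σ.reg 18))

/-- The search starts from the value `0` and accepts ties. As values are nonnegative, the first open
node met is always taken, even if its value is `0`. -/
theorem select_runs (hW : n * n + 4 * I.size + 3 * I.k + 3 ≤ W) {σ₀ : State K}
    (h0 : ∀ z < I.size, 0 ≤ σ₀.numMem (n * n + z))
    (y : ℕ) (σ : State K) (h : I.SelectInv σ₀ (y + 1) σ) :
    Runs sz W S selectCmd { σ with reg := Function.update σ.reg 17 y } selectCmd.steps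
      (I.SelectInv σ₀ y) := by
  have hy : y < I.size := h.le
  have hR := h.ready
  apply Runs.of_wp
  simp only [selectCmd, Cmd.block, Cmd.wp, Op.Fits, Op.Small, Op.run, Test.Holds]
  simp [hR.r6, hR.r10, h.mem_eq, h.numMem_eq]
  refine ⟨by omega, fun hc => ⟨fun hle => ?_, fun hlt => ?_⟩, fun hc => ?_⟩
  · refine ⟨hR.congr (by intro r hr; simp (disch := omega) only [Function.update_of_ne]) (by simp)
      (by simp) (by simp), rfl, rfl, hy.le, by simpa using h.r16, by simp,
      by simpa using h0 y hy, fun z hz hyz hop => ?_, .inr ⟨by simpa using hy, by simpa using hc, by simp⟩⟩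
    rcases eq_or_lt_of_le hyz with rfl | hlt
    · simp
    · simpa using (h.max z hz hlt hop).trans hle
  · refine ⟨hR.congr (by intro r hr; simp (disch := omega) only [Function.update_of_ne]) (by simp)
      (by simp) (by simp), rfl, rfl, hy.le, by simpa using h.r16, by simp,
      by simpa using h.nonneg, fun z hz hyz hop => ?_, ?_⟩
    · rcases eq_or_lt_of_le hyz with rfl | hlt'
      · simpa using hlt.le
      · simpa using h.max z hz hlt' hop
    · rcases h.found with h1 | h1
      · rw [h1.2] at hlt
        exact absurd (h0 y hy) (not_le.2 hlt)
      · exact .inr (by simpa using h1)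
  · refine ⟨hR.congr (by intro r hr; simp (disch := omega) only [Function.update_of_ne]) (by simp)
      (by simp) (by simp), rfl, rfl, hy.le, by simpa using h.r16, by simp,
      by simpa using h.nonneg, fun z hz hyz hop => ?_, ?_⟩
    · rcases eq_or_lt_of_le hyz with rfl | hlt'
      · exact absurd hop hc
      · simpa using h.max z hz hlt' hop
    · rcases h.found with h1 | h1
      · refine .inl ⟨fun z hz hyz => ?_, by simpa using h1.2⟩
        rcases eq_or_lt_of_le hyz with rfl | hlt'
        · exact hc
        · exact h1.1 z hz hlt'
      · exact .inr (by simpa using h1)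

/-! ### One round of Dijkstra's algorithm -/

/-- The invariant of the main loop. -/
structure StageInv (I : MRPInstance K n) (sz : K → ℕ) (B r : ℕ) (σ : State K) : Prop where
  ready : I.Ready σ
  tables : I.Tables σ.mem σ.numMem
  r16 : σ.reg 16 = r
  inv : DijkstraInv sz B I.size I.s I.weight r (fun y => σ.numMem (n * n + y))
    (fun y => σ.mem (n * n + y)) (fun y => σ.mem (n * n + I.size + y))

theorem source_lt (I : MRPInstance K n) : (I.s : ℕ) < I.size := I.s.2.trans_le I.le_size

/-- The number of steps of an iteration of the main loop. -/
def stageSteps (N : ℕ) : ℕ :=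
  openCmd.steps + (N * (selectCmd.steps + 2) + 1 + (closeCmd.steps +
    (N * (weightCmd.steps + updateCmd.steps + 2) + 1)))

theorem dijkstra_runs [IsStrictOrderedRing K] (hW : n * n + 4 * I.size + 3 * I.k + 3 ≤ W)
    (hsz : ∀ a b, sz (a * b) ≤ sz a + sz b) (hwB : ∀ x y, sz (I.weight x y) ≤ B)
    (hS : (I.size + 1) * B ≤ S) (r : ℕ) (σ : State K) (h : I.StageInv sz B (r + 1) σ) :
    Runs sz W S dijkstraCmd { σ with reg := Function.update σ.reg 16 r } (stageSteps I.size)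
      (I.StageInv sz B r) := by
  have hR := h.ready
  have hr : r < I.size := by have := h.inv.card; omega
  refine Runs.seq (Q := I.SelectInv { σ with reg := Function.update σ.reg 16 r } I.size) ?_
    fun τ hτ => Runs.seq (Runs.down (fun i τ hτ => ⟨hτ.ready.r4, hτ.r17⟩)
      (select_runs (σ₀ := { σ with reg := Function.update σ.reg 16 r }) hW h.inv.nonneg) _ τ hτ) fun τ hτ => ?_
  · apply Runs.of_wp
    simp only [openCmd, Cmd.block, Cmd.wp, Op.Fits, Op.Small, Op.run]
    simp [hR.r5, hR.n4]
    refine ⟨hR.congr (by intro r hr; simp (disch := omega) only [Function.update_of_ne]) (by simp)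
      (by simp) (by simp), rfl, rfl, le_rfl, by simp, by simp, by simp, fun z hz hle => ?_,
      .inl ⟨fun z hz hle => ?_, by simp⟩⟩ <;> omega
  obtain ⟨hR', hmem, hnumMem, -, h16, -, -, hmax, hfound⟩ := hτ
  simp only at hmem hnumMem h16 hmax hfound
  rw [Function.update_self] at h16
  have hfound' : τ.reg 18 < I.size ∧ σ.mem (n * n + τ.reg 18) = 0 ∧
      τ.num 1 = σ.numMem (n * n + τ.reg 18) := by
    rcases hfound with h1 | h1
    · obtain ⟨x, hx, hx0⟩ := h.inv.exists_open
      exact absurd hx0 (h1.1 x hx (Nat.zero_le _))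
    · exact h1
  clear hfound
  generalize hx18 : τ.reg 18 = x at hfound'
  obtain ⟨hx, hxo, hn1⟩ := hfound'
  have htab : I.Tables τ.mem τ.numMem := by rw [hmem, hnumMem]; exact h.tables
  have hdiv := div_le hx
  have hmod := I.mod_lt x
  have hidx := I.mod_index_lt x x
  have hle := I.le_size
  refine Runs.seq (Q := I.RelaxInv (fun y => σ.numMem (n * n + y))
    (fun y => if y = x then r + 1 else σ.mem (n * n + y)) (fun y => σ.mem (n * n + I.size + y))
    x r I.size) ?_ fun τ' hτ' => ?_
  · apply Runs.of_wp
    simp only [closeCmd, Cmd.block, Cmd.wp, Op.Fits, Op.Small, Op.run]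
    have el : Function.update τ.mem (n * n + x) (r + 1) (n * n + I.size + I.size + x) = x / n := by
      rw [Function.update_of_ne (by omega), htab.layer x hx]
    have en : Function.update τ.mem (n * n + x) (r + 1) (n * n + I.size + I.size + I.size + x) =
        x % n := by
      rw [Function.update_of_ne (by omega), htab.node x hx]
    simp [hR'.r0, hR'.r4, hR'.r5, hR'.r6, hR'.r8, hR'.r9, hx18, h16, el, en]
    refine ⟨by omega, by omega, by omega, by omega, by omega,
      hR'.congr (by intro r hr; simp (disch := omega) only [Function.update_of_ne]) (by simp)
      (by simp) (by simp), ?_, le_rfl, by simpa using h16, by simpa using hx18, by simp, by simp,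
      by simp, by simp, by simpa using hn1, fun z hz => ?_, fun z hz => ?_, fun z hz => ?_⟩
    · refine htab.congr (fun a ha => ?_) fun a ha => rfl
      simp only
      rw [Function.update_of_ne (by omega)]
    · rw [if_pos (.inr hz)]
      simp only
      rw [hnumMem]
    · rw [if_pos (.inr hz)]
      simp only
      rw [Function.update_of_ne (by omega), hmem]
    · simp only
      by_cases hzx : z = x
      · subst hzx; simp
      · rw [if_neg hzx, Function.update_of_ne (by omega), hmem]
  -- Every product formed must be small, including those that the comparison rejects. The invariant
  -- with `r + 1` rounds to go leaves room for one more factor.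
  · have hsize : ∀ y < I.size, sz (σ.numMem (n * n + x) * I.weight x y) ≤ S := by
      intro y hy
      have h1 := hsz (σ.numMem (n * n + x)) (I.weight x y)
      have h2 := h.inv.size_le x hx
      have h3 := hwB x y
      rw [Nat.add_mul r] at h2
      omega
    refine (Runs.down (fun i τ hτ => ⟨hτ.ready.r4, hτ.r25⟩)
      (relax_runs hW hx hsize) _ τ' hτ').mono le_rfl fun τ'' hτ'' => ?_
    refine ⟨hτ''.ready, hτ''.tables, hτ''.r16, ?_⟩
    refine h.inv.step (fun x y => (I.weight_mem x y).2) hsz hwB hx hxo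
      (fun y hy hyo => ?_) I.source_lt (fun y hy => ?_) (fun y hy => ?_) (fun y hy => ?_)
    · rw [← hn1]
      exact hmax y hy (Nat.zero_le _) hyo
    · simpa using hτ''.value y hy
    · simpa using hτ''.pred y hy
    · exact hτ''.rank_eq y hy

end MRPInstance

/-! ### Initialisation: constants, decoding tables, source -/

namespace MRPInstance

open RAM

variable {K : Type} [Field K] [LinearOrder K] {n : ℕ} {I : MRPInstance K n}
  {sz : K → ℕ} {B W S : ℕ}

theorem start_mem_le (I : MRPInstance K n) (a : ℕ) : I.start.mem a ≤ 1 := by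
  simp only [start]
  split_ifs <;> omega

/-- The loop invariant for the computation of the layers and the underlying nodes. -/
structure DecodeInv (I : MRPInstance K n) (x : ℕ) (σ : State K) : Prop where
  ready : I.Ready σ
  r12 : σ.reg 12 = x
  r13 : σ.reg 13 = x / n
  r14 : σ.reg 14 = x % n
  le : x ≤ I.size
  low : ∀ a < n * n + I.size + I.size, σ.mem a = I.start.mem a
  numMem_eq : σ.numMem = I.start.numMem
  layer : ∀ z < I.size, x ≤ z → σ.mem (n * n + I.size + I.size + z) = z / n
  node : ∀ z < I.size, x ≤ z → σ.mem (n * n + I.size + I.size + I.size + z) = z % n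

theorem init_runs (hW : n * n + 4 * I.size + 3 * I.k + 3 ≤ W) (h1 : sz 1 ≤ S) :
    Runs sz W S initCmd I.start initCmd.steps (I.DecodeInv I.size) := by
  apply Runs.of_wp
  have hs : (I.k + 1) * n = I.size := rfl
  have hdiv : I.size / n = I.k + 1 := Nat.mul_div_cancel _ I.n_pos
  have hmod : I.size % n = 0 := Nat.mul_mod_left _ _
  simp only [initCmd, Cmd.block, Cmd.wp, Op.Fits, Op.Small, Op.run]
  -- Word registers `10` and `14` and number register `4` are never set here; they are `0` in the
  -- initial configuration.
  simp [start, h1, hs]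
  refine ⟨by omega, by omega, by omega, by omega, by omega, by omega, by omega, ?_⟩
  constructor
  case ready => constructor <;> simp
  case low => exact fun a _ => rfl
  case numMem_eq => rfl
  case le => exact le_rfl
  case layer => intro z h h'; omega
  case node => intro z h h'; omega
  all_goals simp [hdiv, hmod]

/-- The machine has no division, so quotient and remainder modulo `n` are maintained while counting
down, with a borrow when the remainder is `0`. -/
theorem decode_runs (hW : n * n + 4 * I.size + 3 * I.k + 3 ≤ W) (x : ℕ) (σ : State K)
    (h : I.DecodeInv (x + 1) σ) :
    Runs sz W S decodeCmd { σ with reg := Function.update σ.reg 12 x } decodeCmd.steps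
      (I.DecodeInv x) := by
  have hx : x < I.size := h.le
  have hR := h.ready
  have hn := I.n_pos
  have key : (1 ≤ (x + 1) % n → (x + 1) / n = x / n ∧ (x + 1) % n - 1 = x % n) ∧
      (¬ 1 ≤ (x + 1) % n → (x + 1) / n - 1 = x / n ∧ n - 1 = x % n) := by
    have e := Nat.div_add_mod' (x + 1) n
    have hlt := Nat.mod_lt (x + 1) hn
    generalize (x + 1) / n = q at e ⊢
    generalize (x + 1) % n = r at e hlt ⊢
    refine ⟨fun hr => ?_, fun hr => ?_⟩
    · have e' : x = q * n + (r - 1) := by omega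
      rw [e', index_div (by omega), index_mod (by omega)]
      simp
    · obtain ⟨q', rfl⟩ : ∃ q', q = q' + 1 := by
        cases q with
        | zero => rw [zero_mul] at e; omega
        | succ q' => exact ⟨q', rfl⟩
      have e' : x = q' * n + (n - 1) := by rw [Nat.succ_mul] at e; omega
      rw [e', index_div (by omega), index_mod (by omega)]
      simp
  have post : ∀ τ : State K, I.Ready τ → τ.reg 12 = x → τ.reg 13 = x / n → τ.reg 14 = x % n →
      τ.mem = Function.update (Function.update σ.mem (n * n + I.size + I.size + x) (x / n))
        (n * n + I.size + I.size + I.size + x) (x % n) → τ.numMem = σ.numMem →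
      I.DecodeInv x τ := by
    intro τ h1 h2 h3 h4 h5 h6
    refine ⟨h1, h2, h3, h4, hx.le, fun a ha => ?_, h6.trans h.numMem_eq, fun z hz hxz => ?_,
      fun z hz hxz => ?_⟩
    · rw [h5, Function.update_of_ne (by omega), Function.update_of_ne (by omega), h.low a ha]
    · rw [h5, Function.update_of_ne (by omega)]
      by_cases hzx : z = x
      · subst hzx; simp
      · rw [Function.update_of_ne (by omega), h.layer z hz (by omega)]
    · rw [h5]
      by_cases hzx : z = x
      · subst hzx; simp
      · rw [Function.update_of_ne (by omega), Function.update_of_ne (by omega),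
          h.node z hz (by omega)]
  apply Runs.of_wp
  simp only [decodeCmd, Cmd.block, Cmd.wp, Op.Fits, Op.Small, Op.run, Test.Holds]
  simp [hR.r0, hR.r4, hR.r8, hR.r9, h.r13, h.r14]
  refine ⟨fun hc => ?_, fun hc => ?_⟩
  · obtain ⟨k1, k2⟩ := key.1 (by omega)
    rw [k1, k2]
    refine ⟨by omega, by omega, post _ (hR.congr (by
      intro r hr; simp (disch := omega) only [Function.update_of_ne]) (by simp) (by simp) (by simp))
      (by simp) (by simp [h.r13, k1]) (by simp) rfl rfl⟩
  · obtain ⟨k1, k2⟩ := key.2 (by omega)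
    rw [k1, k2]
    refine ⟨by omega, by omega, post _ (hR.congr (by
      intro r hr; simp (disch := omega) only [Function.update_of_ne]) (by simp) (by simp) (by simp))
      (by simp) (by simp) (by simp) rfl rfl⟩

theorem source_runs [IsStrictOrderedRing K] (hW : n * n + 4 * I.size + 3 * I.k + 3 ≤ W)
    (h0 : sz 0 ≤ B) (h1 : sz 1 ≤ B) {σ : State K} (h : I.DecodeInv 0 σ) :
    Runs sz W S sourceCmd σ sourceCmd.steps (I.StageInv sz B I.size) := by
  have hR := h.ready
  have hs := I.source_lt
  have hz : ∀ a, n * n ≤ a → I.start.mem a = 0 := fun a ha => by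
    simp [start, Nat.not_lt.2 ha]
  have hz' : ∀ a, n * n ≤ a → I.start.numMem a = 0 := fun a ha => by
    simp [start, Nat.not_lt.2 ha]
  apply Runs.of_wp
  simp only [sourceCmd, Cmd.block, Cmd.wp, Op.Fits, Op.Small, Op.run]
  simp [hR.r2, hR.r5, hR.r6, hR.r7, hR.n5]
  refine ⟨by omega, by omega, ?_⟩
  refine ⟨hR.congr (by intro r hr; simp (disch := omega) only [Function.update_of_ne]) rfl rfl rfl,
    ⟨fun a ha => ?_, fun a ha => ?_, fun x hx => ?_, fun x hx => ?_⟩, by simp,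
    .init hs h0 h1 (fun y hy => ?_) (fun y hy => ?_) ?_⟩
  · simp only
    rw [Function.update_of_ne (by omega), h.low a (by omega)]
  · simp only
    rw [Function.update_of_ne (by omega), h.numMem_eq]
  · simp only
    rw [Function.update_of_ne (by omega), h.layer x hx (Nat.zero_le _)]
  · simp only
    rw [Function.update_of_ne (by omega), h.node x hx (Nat.zero_le _)]
  · by_cases hys : y = I.s
    · subst hys; simp
    · simp only [if_neg hys]
      rw [Function.update_of_ne (by omega), h.numMem_eq, hz' _ (by omega)]
  · simp only
    rw [Function.update_of_ne (by omega), h.low _ (by omega), hz _ (by omega)]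
  · simp

/-! ### Tracing back an optimal path -/

/-- The state of the backward search for an optimal path: the current node `x` of the layered graph,
the number `c` of marks, and the marked adjacency matrix `m`. -/
structure TraceInv (I : MRPInstance K n) (σ₀ : State K) (i x c : ℕ) (m : ℕ → ℕ) : Prop where
  high : ∀ a, n * n ≤ a → m a = σ₀.mem a
  low : ∀ a < n * n, m a = I.start.mem a ∨ (I.start.mem a = 0 ∧ m a = 2)
  lt : x < I.size
  count : ((Finset.range (n * n)).filter fun a => m a = 2).card = c
  -- Every mark is paid for by descending one layer.
  budget : c + x / n ≤ I.k
  -- Each round raises the rank and lowers `i` by one. At `i = 0` the rank would exceed its maximum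
  -- `I.size`, so the source has been reached.
  fuel : x = I.s ∨ (0 < σ₀.numMem (n * n + x) ∧ I.size < σ₀.mem (n * n + x) + i)
  link : 0 < σ₀.numMem (n * n + (I.k * n + I.t)) → Relation.ReflTransGen
    (I.Link (fun x => σ₀.numMem (n * n + x)) m) x (I.k * n + I.t)

/-- The source is its own predecessor, so the trace idles there. Elsewhere positivity of the value
gives a positive weight, so the predecessor lies in the same layer or one below. A step up at the
same node may mark a missing loop; this is harmless, being paid for by a layer as well. -/
theorem TraceInv.step {σ₀ : State K} (h₀ : I.StageInv sz B 0 σ₀) {i x c c' : ℕ} {m m' : ℕ → ℕ}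
    [IsStrictOrderedRing K]
    (h : I.TraceInv σ₀ (i + 1) x c m) {y : ℕ} (hy : σ₀.mem (n * n + I.size + x) = y)
    (high : ∀ a, n * n ≤ a → m' a = m a)
    (low : ∀ a < n * n, m' a = I.start.mem a ∨ (I.start.mem a = 0 ∧ m' a = 2))
    (mono : ∀ a, m a = 2 → m' a = 2)
    (count : ((Finset.range (n * n)).filter fun a => m' a = 2).card = c')
    (hc : c' ≤ c + if y / n + 1 ≤ x / n then 1 else 0)
    (mark : y / n + 1 ≤ x / n → I.start.mem (y % n * n + x % n) = 0 →
      m' (y % n * n + x % n) = 2) :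
    I.TraceInv σ₀ i y c' m' := by
  have hb := h.budget
  have hmono : 0 < σ₀.numMem (n * n + (I.k * n + I.t)) → Relation.ReflTransGen
      (I.Link (fun x => σ₀.numMem (n * n + x)) m') x (I.k * n + I.t) := fun hpos =>
    Relation.ReflTransGen.mono (fun a b ⟨h1, h2, h3, h4, h5⟩ =>
      ⟨h1, h2, h3, h4, fun h6 h7 => mono _ (h5 h6 h7)⟩) _ _ (h.link hpos)
  by_cases hxs : x = I.s
  · subst hxs
    obtain rfl : (I.s : ℕ) = y := by rw [← hy]; exact h₀.inv.par_src.symm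
    rw [if_neg (by omega)] at hc
    exact ⟨fun a ha => (high a ha).trans (h.high a ha), low, h.lt, count, by omega, .inl rfl, hmono⟩
  · obtain ⟨hpos, hrank⟩ := h.fuel.resolve_left hxs
    obtain ⟨h1, h2, h3⟩ := h₀.inv.parent x h.lt hxs hpos
    simp only [hy] at h1 h2 h3
    have hDy := h₀.inv.nonneg y h1
    have hDpos : 0 < σ₀.numMem (n * n + y) := by
      refine lt_of_le_of_ne hDy fun hz => ?_
      rw [← hz, zero_mul] at h3
      exact hpos.ne' h3
    have hw : I.weight y x ≠ 0 := fun hz => by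
      rw [hz, mul_zero] at h3
      exact hpos.ne' h3
    have hlayer : x / n = y / n ∨ x / n = y / n + 1 := by
      by_contra hc
      push Not at hc
      exact hw (weight_other hc.1 hc.2)
    refine ⟨fun a ha => (high a ha).trans (h.high a ha), low, h1, count, ?_,
      .inr ⟨hDpos, by omega⟩, fun hp => (hmono hp).head ⟨h1, h.lt, hpos, h3, mark⟩⟩
    rcases hlayer with h4 | h4
    · rw [h4, if_neg (by omega)] at hc
      rw [h4] at hb
      omega
    · rw [h4, if_pos le_rfl] at hc
      rw [h4] at hb
      omega

theorem target_runs [IsStrictOrderedRing K] (hW : n * n + 4 * I.size + 3 * I.k + 3 ≤ W)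
    {σ₀ : State K} (h₀ : I.StageInv sz B 0 σ₀) :
    Runs sz W S targetCmd σ₀ targetCmd.steps fun τ => I.Ready τ ∧ τ.reg 16 = I.size ∧
      I.TraceInv σ₀ I.size (τ.reg 12) (τ.reg 13) τ.mem := by
  have hR := h₀.ready
  have ht : I.k * n + I.t < I.size := index_lt le_rfl I.t.2
  have hcount : ((Finset.range (n * n)).filter fun a => σ₀.mem a = 2).card = 0 := by
    rw [Finset.card_eq_zero, Finset.filter_false_of_mem]
    intro a ha h2
    have := I.start_mem_le a
    rw [h₀.tables.adj a (Finset.mem_range.1 ha)] at h2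
    omega
  apply Runs.of_wp
  simp only [targetCmd, Cmd.block, Cmd.wp, Op.Fits, Op.Small, Op.run, Test.Holds]
  simp [hR.r0, hR.r1, hR.r2, hR.r3, hR.r5, hR.r6, hR.n4]
  -- If the target has value `0`, the trace starts at the source and marks nothing.
  refine ⟨by omega, by omega, by omega, fun hc => ⟨hR.congr
    (by intro r hr; simp (disch := omega) only [Function.update_of_ne]) (by simp) (by simp) (by simp),
    fun a _ => rfl, fun a ha => .inl (h₀.tables.adj a ha), I.source_lt, hcount, ?_, .inl rfl,
    fun hp => absurd hc (not_le.2 hp)⟩, fun hc => ⟨hR.congr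
    (by intro r hr; simp (disch := omega) only [Function.update_of_ne]) (by simp) (by simp) (by simp),
    fun a _ => rfl, fun a ha => .inl (h₀.tables.adj a ha), ht, hcount, ?_, .inr ⟨hc, ?_⟩,
    fun _ => .refl⟩⟩
  · rw [Nat.div_eq_of_lt I.s.2]; omega
  · rw [index_div I.t.2]; omega
  · have := h₀.inv.rank_ne_zero ht
    omega

theorem trace_runs [IsStrictOrderedRing K] (hW : n * n + 4 * I.size + 3 * I.k + 3 ≤ W)
    {σ₀ : State K} (h₀ : I.StageInv sz B 0 σ₀) (i : ℕ) (σ : State K)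
    (h : I.Ready σ ∧ σ.reg 16 = i + 1 ∧ I.TraceInv σ₀ (i + 1) (σ.reg 12) (σ.reg 13) σ.mem) :
    Runs sz W S traceCmd { σ with reg := Function.update σ.reg 16 i } traceCmd.steps fun τ =>
      I.Ready τ ∧ τ.reg 16 = i ∧ I.TraceInv σ₀ i (τ.reg 12) (τ.reg 13) τ.mem := by
  obtain ⟨hR, -, h⟩ := h
  generalize hx : σ.reg 12 = x at h
  generalize hcn : σ.reg 13 = c at h
  have hxl := h.lt
  have hy' : σ₀.mem (n * n + I.size + x) < I.size := by
    by_cases hxs : x = I.s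
    · subst hxs
      have := h₀.inv.par_src
      rw [this]
      exact hxl
    · exact (h₀.inv.parent x hxl hxs (h.fuel.resolve_left hxs).1).1
  generalize hy : σ₀.mem (n * n + I.size + x) = y at hy'
  have hmem : σ.mem (n * n + I.size + x) = y := by rw [h.high _ (by omega), hy]
  have hlx : σ.mem (n * n + I.size + I.size + x) = x / n := by
    rw [h.high _ (by omega), h₀.tables.layer x hxl]
  have hly : σ.mem (n * n + I.size + I.size + y) = y / n := by
    rw [h.high _ (by omega), h₀.tables.layer y hy']
  have hnx : σ.mem (n * n + I.size + I.size + I.size + x) = x % n := by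
    rw [h.high _ (by omega), h₀.tables.node x hxl]
  have hny : σ.mem (n * n + I.size + I.size + I.size + y) = y % n := by
    rw [h.high _ (by omega), h₀.tables.node y hy']
  have e1 := div_le hxl
  have e2 := div_le hy'
  have e5 := I.mod_index_lt y x
  have hck := h.budget
  have hk : c ≤ I.k := by omega
  -- Rounds without a new mark: no layer is left, the edge exists already, or it was marked earlier.
  have keep : (y / n + 1 ≤ x / n → σ.mem (y % n * n + x % n) ≠ 0) → I.TraceInv σ₀ i y c σ.mem := by
    intro hz
    refine h.step h₀ hy (fun a _ => rfl) h.low (fun a ha => ha) h.count (by omega) ?_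
    intro h1 h2
    rcases h.low _ e5 with h3 | h3
    · rw [h2] at h3
      exact absurd h3 (hz h1)
    · exact h3.2
  apply Runs.of_wp
  simp only [traceCmd, Cmd.block, Cmd.wp, Op.Fits, Op.Small, Op.run, Test.Holds]
  simp [-Order.add_one_le_iff, hR.r0, hR.r4, hR.r7, hR.r8, hR.r9, hR.r10, hx, hcn, hmem, hlx, hly,
    hnx, hny]
  refine ⟨by omega, by omega, by omega, by omega, fun hc => ⟨by omega, by omega, by omega, by omega,
    fun hz => ⟨by omega, by omega, hR.congr
      (by intro r hr; simp (disch := omega) only [Function.update_of_ne]) (by simp) (by simp) (by simp),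
      h.step h₀ hy (fun a ha => ?_) (fun a ha => ?_) (fun a ha => ?_) ?_ ?_ fun _ _ => by simp⟩,
    fun hz => ⟨hR.congr
      (by intro r hr; simp (disch := omega) only [Function.update_of_ne]) (by simp) (by simp) (by simp),
      keep fun _ => hz⟩⟩,
    fun hc => ⟨hR.congr
      (by intro r hr; simp (disch := omega) only [Function.update_of_ne]) (by simp) (by simp) (by simp),
      keep fun hc' => absurd hc' (by omega)⟩⟩
  · rw [Function.update_of_ne (by omega)]
  · by_cases ha' : a = y % n * n + x % n
    · subst ha'
      right
      rw [Function.update_self]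
      rcases h.low _ ha with h3 | h3
      · exact ⟨by omega, rfl⟩
      · exact ⟨h3.1, rfl⟩
    · rw [Function.update_of_ne ha']
      exact h.low a ha
  · by_cases ha' : a = y % n * n + x % n
    · subst ha'; simp
    · rw [Function.update_of_ne ha']; exact ha
  · have e : ((Finset.range (n * n)).filter fun a =>
        Function.update σ.mem (y % n * n + x % n) 2 a = 2) =
        insert (y % n * n + x % n) ((Finset.range (n * n)).filter fun a => σ.mem a = 2) := by
      ext a
      simp only [Finset.mem_filter, Finset.mem_range, Finset.mem_insert]
      by_cases ha' : a = y % n * n + x % n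
      · subst ha'; simp [e5]
      · rw [Function.update_of_ne ha']; simp [ha']
    rw [e, Finset.card_insert_of_notMem (by simp [hz]), h.count]
  · rw [if_pos (by omega)]

end MRPInstance

/-! ### Producing exactly `k` new edges -/

namespace MRPInstance

open RAM

variable {K : Type} [Field K] [LinearOrder K] {n : ℕ} {I : MRPInstance K n}
  {sz : K → ℕ} {B W S : ℕ}

/-- The loop invariant for the output of the chosen edges, where `m₀` is the marked adjacency matrix
and `c₀` the number of marks. -/
structure FillInv (I : MRPInstance K n) (m₀ : ℕ → ℕ) (c₀ i : ℕ) (σ : State K) : Prop where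
  r1 : σ.reg 1 = I.k
  r4 : σ.reg 4 = 1
  r12 : σ.reg 12 = i
  le : i ≤ n * n
  low : ∀ a < i, σ.mem a = m₀ a
  existing : ∀ a, i ≤ a → a < n * n → m₀ a = 1 → σ.mem a = 0
  marked : ∀ a, i ≤ a → a < n * n → m₀ a = 2 → σ.mem a = 1
  -- The filling is greedy: while budget remains, no missing edge has been passed over.
  missing : ∀ a, i ≤ a → a < n * n → m₀ a = 0 → σ.mem a ≤ 1 ∧ (σ.reg 13 < I.k → σ.mem a = 1)
  count : c₀ + ((Finset.range (n * n)).filter fun a => i ≤ a ∧ m₀ a = 0 ∧ σ.mem a = 1).card =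
    σ.reg 13
  budget : σ.reg 13 ≤ I.k

theorem fill_runs (hW : n * n + 4 * I.size + 3 * I.k + 3 ≤ W) {m₀ : ℕ → ℕ} {c₀ : ℕ} (i : ℕ)
    (σ : State K) (h : I.FillInv m₀ c₀ (i + 1) σ) :
    Runs sz W S fillCmd { σ with reg := Function.update σ.reg 12 i } fillCmd.steps
      (I.FillInv m₀ c₀ i) := by
  have hi : i < n * n := h.le
  have hmi : σ.mem i = m₀ i := h.low i (by omega)
  have hb := h.budget
  have hc := h.count
  have same : ∀ m : ℕ → ℕ, (∀ a, i < a → m a = σ.mem a) → ¬ (m₀ i = 0 ∧ m i = 1) →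
      ((Finset.range (n * n)).filter fun a => i ≤ a ∧ m₀ a = 0 ∧ m a = 1) =
      (Finset.range (n * n)).filter fun a => i + 1 ≤ a ∧ m₀ a = 0 ∧ σ.mem a = 1 := by
    intro m hm hni
    refine Finset.filter_congr fun a _ => ?_
    constructor
    · rintro ⟨h1, h2, h3⟩
      have : a ≠ i := by rintro rfl; exact hni ⟨h2, h3⟩
      exact ⟨by omega, h2, by rw [← hm a (by omega)]; exact h3⟩
    · rintro ⟨h1, h2, h3⟩
      exact ⟨by omega, h2, by rw [hm a (by omega)]; exact h3⟩
  apply Runs.of_wp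
  simp only [fillCmd, Cmd.block, Cmd.wp, Op.Fits, Op.Small, Op.run, Test.Holds]
  simp [-Order.add_one_le_iff, h.r1, h.r4, hmi]
  refine ⟨fun hv => ?_, fun hv => ⟨by omega, fun hlt => ?_, fun hge => ?_⟩⟩
  · refine ⟨by simpa using h.r1, by simpa using h.r4, by simp, hi.le, fun a ha => ?_,
      fun a ha ha' ha1 => ?_, fun a ha ha' ha2 => ?_, fun a ha ha' ha0 => ?_, ?_, by simpa using hb⟩
    · simp only
      rw [Function.update_of_ne (by omega), h.low a (by omega)]
    · simp only
      by_cases hai : a = i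
      · subst hai; simp [ha1]
      · rw [Function.update_of_ne hai, h.existing a (by omega) ha' ha1]
    · simp only
      by_cases hai : a = i
      · subst hai; simp [ha2]
      · rw [Function.update_of_ne hai, h.marked a (by omega) ha' ha2]
    · have hai : a ≠ i := by rintro rfl; omega
      have := h.missing a (by omega) ha' ha0
      simpa [Function.update_of_ne hai] using this
    · simp only
      rw [same _ (fun a ha => Function.update_of_ne (by omega) _ _) (fun h1 => by omega), hc]
      simp
  · have e : ((Finset.range (n * n)).filter fun a =>
        i ≤ a ∧ m₀ a = 0 ∧ Function.update σ.mem i 1 a = 1) = insert i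
        ((Finset.range (n * n)).filter fun a => i + 1 ≤ a ∧ m₀ a = 0 ∧ σ.mem a = 1) := by
      ext a
      simp only [Finset.mem_filter, Finset.mem_range, Finset.mem_insert]
      by_cases hai : a = i
      · subst hai; simp; omega
      · rw [Function.update_of_ne hai]
        refine ⟨fun ⟨h1, h2, h3⟩ => .inr ⟨h1, by omega, h3⟩, fun h1 => ?_⟩
        obtain ⟨h1, h2, h3⟩ := h1.resolve_left hai
        exact ⟨h1, by omega, h3⟩
    refine ⟨by simpa using h.r1, by simpa using h.r4, by simp, hi.le, fun a ha => ?_,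
      fun a ha ha' ha1 => ?_, fun a ha ha' ha2 => ?_, fun a ha ha' ha0 => ?_, ?_, by simp; omega⟩
    · simp only
      rw [Function.update_of_ne (by omega), h.low a (by omega)]
    · have hai : a ≠ i := by rintro rfl; omega
      simp only
      rw [Function.update_of_ne hai, h.existing a (by omega) ha' ha1]
    · have hai : a ≠ i := by rintro rfl; omega
      simp only
      rw [Function.update_of_ne hai, h.marked a (by omega) ha' ha2]
    · by_cases hai : a = i
      · subst hai; simp
      · have := h.missing a (by omega) ha' ha0
        simp only [Function.update_of_ne hai]
        exact ⟨this.1, fun _ => this.2 (by omega)⟩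
    · simp only
      rw [e, Finset.card_insert_of_notMem (by simp), Function.update_self]
      omega
  · refine ⟨by simpa using h.r1, by simpa using h.r4, by simp, hi.le, fun a ha => h.low a (by omega),
      fun a ha ha' ha1 => ?_, fun a ha ha' ha2 => ?_, fun a ha ha' ha0 => ?_, ?_, by simpa using hb⟩
    · have hai : a ≠ i := by rintro rfl; omega
      exact h.existing a (by omega) ha' ha1
    · have hai : a ≠ i := by rintro rfl; omega
      exact h.marked a (by omega) ha' ha2
    · by_cases hai : a = i
      · subst hai
        simp [hmi, ha0]
        omega
      · simpa using h.missing a (by omega) ha' ha0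
    · simp only
      rw [same _ (fun a ha => rfl) (fun h1 => by omega), hc]
      simp

theorem card_index_filter (p : ℕ → Prop) [DecidablePred p] :
    (Finset.univ.filter fun e : Fin n × Fin n => p (e.1 * n + e.2)).card =
      ((Finset.range (n * n)).filter p).card := by
  refine Finset.card_bij (fun e _ => (e.1 : ℕ) * n + e.2) ?_ ?_ ?_
  · intro e he
    simp only [Finset.mem_filter, Finset.mem_univ, true_and, Finset.mem_range] at he ⊢
    exact ⟨square_index_lt _ _, he⟩
  · intro e _ e' _ hee
    have h1 := congrArg (· / n) hee
    have h2 := congrArg (· % n) hee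
    simp only [index_div e.2.2, index_div e'.2.2, index_mod e.2.2, index_mod e'.2.2] at h1 h2
    exact Prod.ext (Fin.ext h1) (Fin.ext h2)
  · intro a ha
    simp only [Finset.mem_filter, Finset.mem_range] at ha
    have hn : 0 < n := Nat.pos_of_ne_zero fun h => by simp [h] at ha
    refine ⟨(⟨a / n, (Nat.div_lt_iff_lt_mul hn).2 ha.1⟩, ⟨a % n, Nat.mod_lt _ hn⟩), ?_,
      Nat.div_add_mod' a n⟩
    simpa [Nat.div_add_mod' a n] using ha.2

/-- The edge set that the program outputs. -/
def output (m : ℕ → ℕ) : Finset (Fin n × Fin n) :=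
  Finset.univ.filter fun e => m (e.1 * n + e.2) = 1

/-- The output consists of the marked edges and the greedily added ones, all missing from the graph.
If fewer than `k` were output, all missing edges would have been taken, against `k ≤ |Eᶜ|`. -/
theorem FillInv.isFeasible {m₀ : ℕ → ℕ} {c₀ : ℕ} {σ : State K} (h : I.FillInv m₀ c₀ 0 σ)
    (hm : ∀ a < n * n, m₀ a = I.start.mem a ∨ (I.start.mem a = 0 ∧ m₀ a = 2))
    (hc : ((Finset.range (n * n)).filter fun a => m₀ a = 2).card = c₀) :
    I.IsFeasible (output σ.mem) := by
  have hsub : output σ.mem ⊆ I.G.edgesᶜ := by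
    intro e he
    simp only [output, Finset.mem_filter, Finset.mem_univ, true_and] at he
    rw [Finset.mem_compl]
    intro hmem
    have hs := I.start_mem e.1 e.2
    rw [if_pos hmem] at hs
    have hlt := square_index_lt e.1 e.2
    have h1 : m₀ (e.1 * n + e.2) = 1 := by
      rcases hm _ hlt with h1 | h1 <;> omega
    have := h.existing _ (Nat.zero_le _) hlt h1
    omega
  have hcard : (output (n := n) σ.mem).card = σ.reg 13 := by
    rw [output, card_index_filter (fun a => σ.mem a = 1), ← h.count, ← hc,
      ← Finset.card_union_of_disjoint]
    · congr 1
      ext a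
      simp only [Finset.mem_union, Finset.mem_filter, Finset.mem_range, Nat.zero_le, true_and]
      constructor
      · rintro ⟨h1, h2⟩
        have h3 := hm a h1
        have h4 := I.start_mem_le a
        have h5 := h.existing a (Nat.zero_le _) h1
        by_cases h6 : m₀ a = 2
        · exact .inl ⟨h1, h6⟩
        · exact .inr ⟨h1, by omega, h2⟩
      · rintro (⟨h1, h2⟩ | ⟨h1, h2, h3⟩)
        · exact ⟨h1, h.marked a (Nat.zero_le _) h1 h2⟩
        · exact ⟨h1, h3⟩
    · rw [Finset.disjoint_left]
      intro a h1 h2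
      simp only [Finset.mem_filter] at h1 h2
      omega
  refine ⟨hsub, le_antisymm (hcard ▸ h.budget) ?_⟩
  by_contra hlt
  rw [hcard, not_le] at hlt
  have : I.G.edgesᶜ ⊆ output σ.mem := by
    intro e he
    rw [Finset.mem_compl] at he
    have hs := I.start_mem e.1 e.2
    rw [if_neg he] at hs
    have hidx := square_index_lt e.1 e.2
    simp only [output, Finset.mem_filter, Finset.mem_univ, true_and]
    rcases hm _ hidx with h1 | h1
    · exact (h.missing _ (Nat.zero_le _) hidx (h1.trans hs)).2 hlt
    · exact h.marked _ (Nat.zero_le _) hidx h1.2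
  have h1 := Finset.card_le_card this
  have h2 := I.k_le
  omega

/-! ### The whole program and its running time -/

/-- The number of steps of the program. -/
def totalSteps (n N : ℕ) : ℕ :=
  initCmd.steps + (N * (decodeCmd.steps + 2) + 1 + (sourceCmd.steps +
    (N * (stageSteps N + 2) + 1 + (targetCmd.steps + (N * (traceCmd.steps + 2) + 1 +
      (1 + (n * n * (fillCmd.steps + 2) + 1)))))))

theorem improveCmd_runs [IsStrictOrderedRing K] (hW : n * n + 4 * I.size + 3 * I.k + 3 ≤ W)
    (hsz : ∀ a b, sz (a * b) ≤ sz a + sz b) (h0 : sz 0 ≤ B) (h1 : sz 1 ≤ B) (hζ : sz I.ζ ≤ B)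
    (hentry : ∀ e, sz (I.entry e) ≤ B) (hS : (I.size + 1) * B ≤ S) :
    Runs sz W S improveCmd I.start (totalSteps n I.size) fun τ =>
      ∃ E₁, Outputs τ E₁ ∧ I.IsSolution E₁ := by
  have hBS : B ≤ S := (Nat.le_mul_of_pos_left _ (by omega)).trans hS
  have hwB : ∀ x y, sz (I.weight x y) ≤ B := by
    intro x y
    simp only [weight, start]
    split_ifs <;> first | exact hentry _ | assumption
  refine (init_runs hW (h1.trans hBS)).seq fun τ hτ => ?_
  refine (Runs.down (fun i τ hτ => ⟨hτ.ready.r4, hτ.r12⟩) (decode_runs hW) _ τ hτ).seq fun τ hτ => ?_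
  refine (source_runs hW h0 h1 hτ).seq fun τ hτ => ?_
  refine (Runs.down (fun i τ hτ => ⟨hτ.ready.r4, hτ.r16⟩) (dijkstra_runs hW hsz hwB hS) _ τ
    hτ).seq fun σ₀ h₀ => ?_
  refine (target_runs hW h₀).seq fun τ hτ => ?_
  refine (Runs.down (Inv := fun i τ => I.Ready τ ∧ τ.reg 16 = i ∧
    I.TraceInv σ₀ i (τ.reg 12) (τ.reg 13) τ.mem) (fun i τ hτ => ⟨hτ.1.r4, hτ.2.1⟩)
    (trace_runs hW h₀) _ τ hτ).seq fun σ₁ h₁ => ?_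
  obtain ⟨hR, -, ht⟩ := h₁
  refine Runs.seq (Q := I.FillInv σ₁.mem (σ₁.reg 13) (n * n)) ?_ fun τ hτ =>
    (Runs.down (fun i τ hτ => ⟨hτ.r4, hτ.r12⟩) (fill_runs hW) _ τ hτ).mono le_rfl fun τ hτ => ?_
  · refine Runs.of_wp (P := .op (.move 12 6)) ?_
    simp only [Cmd.wp, Op.Fits, Op.Small, Op.run]
    have hb := ht.budget
    refine ⟨trivial, trivial, by simpa using hR.r1, by simpa using hR.r4, by simpa using hR.r6,
      le_rfl, fun a _ => rfl, fun a h h' => by omega, fun a h h' => by omega,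
      fun a h h' => by omega, ?_,
      by simpa using (Nat.le_add_right _ _).trans hb⟩
    rw [Finset.filter_false_of_mem]
    · simp
    · intro a ha
      have := Finset.mem_range.1 ha
      omega
  · have hfeas := hτ.isFeasible ht.low ht.count
    have h0' := h₀.inv.nonneg
    have hs' := h₀.inv.src_eq
    have hD' : ∀ x < I.size, ∀ y < I.size,
        σ₀.numMem (n * n + x) * I.weight x y ≤ σ₀.numMem (n * n + y) := fun x hx y hy =>
      h₀.inv.relaxed x hx y hy (h₀.inv.rank_ne_zero hx)
    refine ⟨output τ.mem, fun i j => ?_, hfeas.isSolution h0' hs' hD' ?_⟩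
    · have hlt := square_index_lt i j
      have h2 := ht.low _ hlt
      have h3 := I.start_mem_le (i * n + j)
      have h4 := hτ.existing _ (Nat.zero_le _) hlt
      have h5 := hτ.marked _ (Nat.zero_le _) hlt
      have h6 := hτ.missing _ (Nat.zero_le _) hlt
      simp only [output, Finset.mem_filter, Finset.mem_univ, true_and]
      split_ifs with h7
      · exact h7
      · omega
    · by_cases hpos : σ₀.numMem (n * n + (I.k * n + I.t)) ≤ 0
      · exact exists_path_of_le_zero hs' hD' hpos
      · have hlink := ht.link (not_le.1 hpos)
        -- No fuel is left: otherwise the current node would have rank above `I.size`.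
        have hx : σ₁.reg 12 = I.s := by
          rcases ht.fuel with h2 | h2
          · exact h2
          · have := h₀.inv.rank_le _ ht.lt
            omega
        rw [hx] at hlink
        refine exists_path_of_link hs' hfeas.1 (fun u v huv => ?_) hlink I.t (index_mod I.t.2)
        simp only [output, Finset.mem_filter, Finset.mem_univ, true_and]
        exact hτ.marked _ (Nat.zero_le _) (square_index_lt u v) huv

theorem solvedBy_improveCmd [IsStrictOrderedRing K] (I : MRPInstance K n) {c : ℕ}
    (hW : n * n + 4 * I.size + 3 * I.k + 3 ≤ W)
    (hsz : ∀ a b, sz (a * b) ≤ sz a + sz b) (h0 : sz 0 ≤ B) (h1 : sz 1 ≤ B) (hζ : sz I.ζ ≤ B)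
    (hentry : ∀ e, sz (I.entry e) ≤ B) (hc : totalSteps n I.size ≤ c) :
    ∃ T, I.SolvedBy sz W improveCmd T ∧ T ≤ c * (1 + 2 * ((I.size + 1) * B)) := by
  have hBS : B ≤ (I.size + 1) * B := Nat.le_mul_of_pos_left _ (by omega)
  have hsmall : I.start.Small sz ((I.size + 1) * B) := by
    refine ⟨fun r => ?_, fun a => ?_⟩ <;> refine le_trans ?_ hBS <;> simp only [start] <;>
      split_ifs <;> first | exact hentry _ | assumption
  obtain ⟨T, τ, h2, h3, -, E₁, h4, h5⟩ := improveCmd_runs hW hsz h0 h1 hζ hentry le_rfl hsmall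
  exact ⟨T, ⟨τ, E₁, h2, h4, h5⟩, h3.trans (Nat.mul_le_mul_right _ hc)⟩

theorem k_le_square (I : MRPInstance K n) : I.k ≤ n * n := by
  refine I.k_le.trans ((Finset.card_le_univ _).trans ?_)
  simp

theorem size_le (I : MRPInstance K n) : I.size ≤ 2 * (I.k * n) := by
  have := Nat.mul_le_mul_right n I.k_pos
  rw [size, Nat.succ_mul]
  omega

/-- From `k ≤ n²` and `I.size ≤ 2 * k * n`, the left side is at most `n² + 8n³ + 3n² + 3`, and `1 +
8 + 3 + 3 = 15`. The exponent is `15` only because a single constant must serve as both factor and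
exponent. -/
theorem wordBound (I : MRPInstance K n) :
    n * n + 4 * I.size + 3 * I.k + 3 ≤ 15 * n ^ 15 := by
  have hn := I.n_pos
  have h1 : n * n ≤ n ^ 15 := by
    rw [← pow_two]; exact Nat.pow_le_pow_right hn (by norm_num)
  have h2 : n * n * n ≤ n ^ 15 := by
    rw [show n * n * n = n ^ 3 by ring]; exact Nat.pow_le_pow_right hn (by norm_num)
  have h3 := I.k_le_square
  have h4 := I.size_le
  have h5 := Nat.mul_le_mul_right n h3
  have h6 : 1 ≤ n ^ 15 := Nat.one_le_pow _ _ hn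
  omega

/-- With `N = I.size` the count is `51N² + 57N + 15n² + 32`, at most `155N²`; the constant `500` is
generous. -/
theorem totalSteps_le (I : MRPInstance K n) : totalSteps n I.size ≤ 500 * (I.size * I.size) := by
  have h1 := I.le_size
  have h2 : 1 ≤ I.size := I.n_pos.trans_le h1
  have h3 : n * n ≤ I.size * I.size := Nat.mul_le_mul h1 h1
  have h4 : I.size ≤ I.size * I.size := Nat.le_mul_of_pos_left _ h2
  simp only [totalSteps, stageSteps, show initCmd.steps = 11 from rfl,
    show decodeCmd.steps = 11 from rfl, show sourceCmd.steps = 6 from rfl,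
    show targetCmd.steps = 10 from rfl, show traceCmd.steps = 25 from rfl,
    show fillCmd.steps = 13 from rfl, show openCmd.steps = 3 from rfl,
    show selectCmd.steps = 12 from rfl, show closeCmd.steps = 10 from rfl,
    show weightCmd.steps = 25 from rfl, show updateCmd.steps = 10 from rfl]
  generalize I.size = N at *
  ring_nf at *
  omega

end MRPInstance

/-! ### Binary lengths and the final bounds -/

theorem Nat.size_mul_le (a b : ℕ) : (a * b).size ≤ a.size + b.size := by
  rw [Nat.size_le, pow_add]
  exact Nat.mul_lt_mul'' a.lt_size_self b.lt_size_self

/-- Reducing the product of two fractions only shrinks numerator and denominator. -/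
theorem RAM.bitLength_mul (a b : ℚ) :
    RAM.bitLength (a * b) ≤ RAM.bitLength a + RAM.bitLength b := by
  have h1 : (a * b).num.natAbs ≤ a.num.natAbs * b.num.natAbs := by
    rw [Rat.mul_num, ← Int.natAbs_mul]
    exact Int.natAbs_ediv_le_natAbs _ _
  have h2 : (a * b).den ≤ a.den * b.den := by
    rw [Rat.mul_den]
    exact Nat.div_le_self _ _
  have h3 := (Nat.size_le_size h1).trans (Nat.size_mul_le _ _)
  have h4 := (Nat.size_le_size h2).trans (Nat.size_mul_le _ _)
  simp only [RAM.bitLength]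
  omega

theorem theorem3 :
    ∃ (P : RAM.Cmd) (c : ℕ),
      (∃ C : ℝ, ∀ (n : ℕ) (I : MRPInstance ℝ n), ∃ T : ℕ,
        I.SolvedBy RAM.unitCost (c * n ^ c) P T ∧
        (T : ℝ) ≤ C * ((I.k : ℝ) ^ 2 * (n : ℝ) ^ 2 +
          (I.k : ℝ) ^ 2 * (n : ℝ) * Real.log ((I.k : ℝ) * (n : ℝ)))) ∧
      (∃ q : Polynomial ℕ, ∀ (n : ℕ) (I : MRPInstance ℚ n), ∃ T : ℕ,
        I.SolvedBy RAM.bitLength (c * n ^ c) P T ∧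
        T ≤ q.eval I.inputBits) := by
  refine ⟨RAM.improveCmd, 15, ⟨2000, fun n I => ?_⟩, ?_⟩
  -- All sizes vanish, so each step costs `1`. The constant is `2000 = 500 * 2²`, from `I.size ≤ 2 *
  -- k * n`.
  · obtain ⟨T, hT, hle⟩ := I.solvedBy_improveCmd (B := 0) I.wordBound (sz := RAM.unitCost)
      (fun _ _ => Nat.zero_le _) le_rfl le_rfl le_rfl (fun _ => le_rfl) I.totalSteps_le
    refine ⟨T, hT, ?_⟩
    have h1 : T ≤ 2000 * (I.k ^ 2 * n ^ 2) := by
      have := Nat.mul_le_mul I.size_le I.size_le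
      calc T ≤ 500 * (I.size * I.size) := by simpa using hle
        _ ≤ 500 * (2 * (I.k * n) * (2 * (I.k * n))) := Nat.mul_le_mul_left _ this
        _ = 2000 * (I.k ^ 2 * n ^ 2) := by ring
    have h2 : (T : ℝ) ≤ 2000 * ((I.k : ℝ) ^ 2 * (n : ℝ) ^ 2) := by exact_mod_cast h1
    have h3 : 0 ≤ Real.log ((I.k : ℝ) * (n : ℝ)) := by
      have : 1 ≤ I.k * n := Nat.mul_pos I.k_pos I.n_pos
      exact Real.log_nonneg (by exact_mod_cast this)
    refine h2.trans (mul_le_mul_of_nonneg_left ?_ (by norm_num))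
    exact le_add_of_nonneg_right (by positivity)
  -- With `X` input bits, `n ≤ n² ≤ X` and `k ≤ n² ≤ X`, so the layered graph has at most `2X²`
  -- nodes and there are at most `500 * (2X²)²` steps. The size bound `B = X + 2` accommodates the
  -- constants `0` and `1`, of lengths `1` and `2`.
  · refine ⟨Polynomial.C 2000 * Polynomial.X ^ 4 * (1 + Polynomial.C 2 *
      ((Polynomial.C 2 * Polynomial.X ^ 2 + 1) * (Polynomial.X + Polynomial.C 2))), fun n I => ?_⟩
    have hB : ∀ q, RAM.bitLength q ≤ I.inputBits → RAM.bitLength q ≤ I.inputBits + 2 :=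
      fun q h => h.trans (Nat.le_add_right _ _)
    have hentry : ∀ e, RAM.bitLength (I.entry e) ≤ I.inputBits := by
      intro e
      have := Finset.single_le_sum (f := fun e => RAM.bitLength (I.entry e))
        (fun _ _ => Nat.zero_le _) (Finset.mem_univ e)
      rw [MRPInstance.inputBits]
      omega
    have hζ : RAM.bitLength I.ζ ≤ I.inputBits := by
      rw [MRPInstance.inputBits]
      omega
    obtain ⟨T, hT, hle⟩ := I.solvedBy_improveCmd (B := I.inputBits + 2) I.wordBound
      (sz := RAM.bitLength) RAM.bitLength_mul (by simp [RAM.bitLength]) (by simp [RAM.bitLength])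
      (hB _ hζ) (fun e => hB _ (hentry e)) I.totalSteps_le
    refine ⟨T, hT, ?_⟩
    have hn : n * n ≤ I.inputBits := by
      rw [MRPInstance.inputBits]
      omega
    have hsize : I.size ≤ 2 * I.inputBits ^ 2 := by
      refine I.size_le.trans (Nat.mul_le_mul_left _ ?_)
      rw [pow_two]
      exact Nat.mul_le_mul (I.k_le_square.trans hn) ((Nat.le_mul_self n).trans hn)
    refine hle.trans ?_
    simp only [Polynomial.eval_mul, Polynomial.eval_add, Polynomial.eval_pow, Polynomial.eval_C,
      Polynomial.eval_X, Polynomial.eval_one]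
    calc _ ≤ 500 * (2 * I.inputBits ^ 2 * (2 * I.inputBits ^ 2)) *
          (1 + 2 * ((2 * I.inputBits ^ 2 + 1) * (I.inputBits + 2))) := by gcongr
      _ = _ := by ring
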